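/- Let $\mathbb{F}_2(D)$ be the field of rational functions in the delay variable $D$ over $\mathbb{F}_2$. Over a frame with qubit set $Q$, a row $[z(D)\,|\,x(D)]$ with $z,x\in\mathbb{F}_2(D)^Q$ represents a shift-invariant Pauli sequence up to phase; it has finite weight if its entries are Laurent polynomials. A *finite-depth gate* is one of the following shift-invariant Clifford gates, given by its action on rows ($l\in\mathbb{Z}$): CNOT from $i$ to $j\neq i$ with delay $l$ ($x_j\mathrel{+}=D^l x_i$, $z_i\mathrel{+}=D^{-l}z_j$); Hadamard on $i$ ($x_i\leftrightarrow z_i$); phase on $i$ ($z_i\mathrel{+}=x_i$); controlled-phase from $i$ to $j\ne i$ with delay $l$ ($z_j\mathrel{+}=D^l x_i$, $z_i\mathrel{+}=D^{-l}x_j$); controlled-phase from $i$ to itself with delay $l\neq0$ ($z_i\mathrel{+}=(D^l+D^{-l})x_i$). An *infinite-depth gate* on $i$, for a nonzero Laurent polynomial $f$, maps $x_i\mapsto x_i/f(D)$ and $z_i\mapsto f(D^{-1})z_i$. A circuit is a finite sequence of gates; it is *online* if there is a bound on the number of consecutive frames on which the repeated elementary step of each gate acts ($|l|+1$ frames for a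 gate with delay $l$, one frame for a Hadamard or phase gate, $\deg f-\operatorname{del} f+1$ frames for the infinite-depth gate of $f$). **Theorem.** Let $n,c,a\ge 0$ and $k$ be integers with $a=n-k-2c$, and let $H(D)=[Z(D)\,|\,X(D)]$ be an $(n-k)\times 2n$ matrix over $\mathbb{F}_2(D)$ with linearly independent rows whose shifted symplectic product matrix is $$Z(D)X^T(D^{-1})+X(D)Z^T(D^{-1})=\bigoplus_{i=1}^{c}J\ \oplus\ \bigoplus_{j=1}^{a}[0],\qquad J=\begin{bmatrix}0&1\\1&0\end{bmatrix}.$$ Then $k+c\ge 0$, and the following holds for some assignment of roles to the sender's qubits. In each frame the sender holds $n$ qubits, namely $c$ halves of ebits whose other halves are $c$ qubits held by the receiver, $a$ ancillas, and $k+c$ information qubits. Let $S_0(D)$ be the stabilizer matrix of the unencoded stream (rows $ZZ$ and $XX$ for each ebit and $Z$ for each ancilla), and let $I_0(D)$ be its information-qubit matrix (rows $Z$ and $X$ for each information qubit). There are 1. an online encoding circuit of finite-depth and infinite-depth gates, acting on the sender's $n$ qubits only, that maps $S_0$ to a matrix whose restriction to the sender's qubits is equal to $H(D)$ up to left multiplication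 by an invertible matrix over $\mathbb{F}_2(D)$ (that is, up to row operations); and 2. an online decoding circuit of finite-depth gates only, acting on all $c+n$ qubits of the frame, which maps rows of finite weight to rows of finite weight and recovers the information qubits: if encoding followed by decoding maps $S_0$ to $S_1$ and $I_0$ to $I_1$, then $I_1=I_0+L\,S_1$ for some matrix $L$ of Laurent polynomials (that is, the logical operators have their original form up to multiplication by stabilizer elements). Thus the code encodes $k+c$ information qubits per frame with the help of $c$ ebits and $a$ ancilla qubits. -/

import Mathlib

noncomputable section

namespace QConv

open Polynomial

/-- Binary rational functions `ℤ₂(D)` in the delay operator `D`. -/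
abbrev K : Type := RatFunc (ZMod 2)

/-- The delay operator. -/
def D : K := RatFunc.X

lemma D_ne_zero : D ≠ 0 := RatFunc.X_ne_zero

/-- Finite-degree, finite-delay binary polynomials in `D`. -/
abbrev Laurent : Type := LaurentPolynomial (ZMod 2)

/-- The inclusion of the binary Laurent polynomials in the rational functions. -/
def Laurent.toK : Laurent →+* K :=
  LaurentPolynomial.eval₂ (algebraMap (ZMod 2) K) (Units.mk0 D D_ne_zero)

lemma aeval_D_inv_injective :
    Function.Injective (Polynomial.aeval (R := ZMod 2) (D⁻¹ : K)) := by
  rw [← transcendental_iff_injective]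
  intro h
  have h2 := h.inv
  rw [inv_inv] at h2
  exact RatFunc.transcendental_X h2

/-- Time reversal: the field homomorphism `f(D) ↦ f(D⁻¹)`. -/
def timeReversal : K →+* K :=
  RatFunc.liftRingHom (Polynomial.aeval (R := ZMod 2) (D⁻¹ : K)).toRingHom (by
    intro p hp
    rw [Submonoid.mem_comap, mem_nonZeroDivisors_iff_ne_zero]
    intro h
    exact (nonZeroDivisors.ne_zero hp)
      (aeval_D_inv_injective (by simpa using h)))

/-- The shifted symplectic product matrix `Z(D) Xᵀ(D⁻¹) + X(D) Zᵀ(D⁻¹)` of the check matrix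
`[Z(D) | X(D)]`. -/
def shiftedSymplecticMatrix {ρ Q : Type} [Fintype Q] (Z X : Matrix ρ Q K) : Matrix ρ ρ K :=
  Z * (X.map timeReversal).transpose + X * (Z.map timeReversal).transpose

/-- Index set of `2c + a` generators: the generators `(0, i)` and `(1, i)` form the `i`-th pair. -/
abbrev GenIdx (c a : ℕ) : Type := (Fin 2 × Fin c) ⊕ Fin a

/-- The standard form `⨁_{i=1}^c J ⊕ ⨁_{j=1}^a [0]` with `J = [[0, 1], [1, 0]]`. -/
def standardForm (c a : ℕ) : Matrix (GenIdx c a) (GenIdx c a) K :=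
  Matrix.fromBlocks (Matrix.blockDiagonal fun _ : Fin c => !![0, 1; 1, 0]) 0 0 0

/-! ### Shift-invariant Clifford gates

A row `[z(D) | x(D)]` of a binary polynomial matrix over the qubits `Q` of a frame is a vector
indexed by `Q ⊕ Q`: `Sum.inl q` is the "Z" entry and `Sum.inr q` the "X" entry of qubit `q`. Each
gate acts in every frame; it is given by its column operation on such rows. -/

/-- Rows `[z(D) | x(D)]`. -/
abbrev Row (Q : Type) : Type := Q ⊕ Q → K

/-- Finite-depth gates of the shift-invariant Clifford group. -/
inductive FiniteGate (Q : Type) : Type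
  /-- CNOT from qubit `i` to qubit `j` in the frame delayed by `l`. -/
  | cnot (i j : Q) (hij : i ≠ j) (l : ℤ)
  /-- Hadamard gate on qubit `i`. -/
  | hadamard (i : Q)
  /-- Phase gate on qubit `i`. -/
  | phase (i : Q)
  /-- Controlled-phase gate from qubit `i` to qubit `j` in the frame delayed by `l`. -/
  | cphase (i j : Q) (hij : i ≠ j) (l : ℤ)
  /-- Controlled-phase gate from qubit `i` to qubit `i` in the frame delayed by `l`. -/
  | cphaseSelf (i : Q) (l : ℤ) (hl : l ≠ 0)

/-- Gates available to the encoder: finite-depth gates, and the infinite-depth `1/f(D)` operation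
on a qubit `i`, where `f` is a nonzero binary Laurent polynomial. -/
inductive Gate (Q : Type) : Type
  | finite (g : FiniteGate Q)
  | infinite (i : Q) (f : Laurent) (hf : f ≠ 0)

section Action

variable {Q : Type} [DecidableEq Q]

/-- Column operation of a finite-depth gate. -/
def FiniteGate.apply : FiniteGate Q → Row Q → Row Q
  | .cnot i j _ l, u =>
      u + Pi.single (Sum.inr j) (D ^ l * u (Sum.inr i))
        + Pi.single (Sum.inl i) (D ^ (-l) * u (Sum.inl j))
  | .hadamard i, u => fun s => u (Equiv.swap (Sum.inl i) (Sum.inr i) s)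
  | .phase i, u => u + Pi.single (Sum.inl i) (u (Sum.inr i))
  | .cphase i j _ l, u =>
      u + Pi.single (Sum.inl j) (D ^ l * u (Sum.inr i))
        + Pi.single (Sum.inl i) (D ^ (-l) * u (Sum.inr j))
  | .cphaseSelf i l _, u =>
      u + Pi.single (Sum.inl i) ((D ^ l + D ^ (-l)) * u (Sum.inr i))

/-- Column operation of a gate. The infinite-depth `1/f(D)` operation on qubit `i` multiplies
column `i` of the "X" matrix by `1/f(D)` and column `i` of the "Z" matrix by `f(D⁻¹)`. -/
def Gate.apply : Gate Q → Row Q → Row Q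
  | .finite g, u => g.apply u
  | .infinite i f _, u =>
      Function.update
        (Function.update u (Sum.inr i) ((Laurent.toK f)⁻¹ * u (Sum.inr i)))
        (Sum.inl i) (timeReversal (Laurent.toK f) * u (Sum.inl i))

/-- Run a circuit (first gate of the list first) on a row. -/
def runRow (C : List (Gate Q)) (u : Row Q) : Row Q :=
  C.foldl (fun v g => g.apply v) u

/-- Run a circuit on every row of a binary polynomial matrix. -/
def run {ρ : Type} (C : List (Gate Q)) (M : Matrix ρ (Q ⊕ Q) K) : Matrix ρ (Q ⊕ Q) K :=
  Matrix.of fun r => runRow C (M r)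

/-- A row of finite weight: all its entries are Laurent polynomials. -/
def FiniteWeight (u : Row Q) : Prop := ∀ s, ∃ f : Laurent, u s = Laurent.toK f

/-- A circuit is a finite-depth operation if it maps every row of finite weight to a row of finite
weight. -/
def IsFiniteDepth (C : List (Gate Q)) : Prop :=
  ∀ u : Row Q, FiniteWeight u → FiniteWeight (runRow C u)

end Action

section Circuits

variable {Q Q' : Type}

/-- Relabel the qubits of a finite-depth gate. -/
def FiniteGate.map (φ : Q ↪ Q') : FiniteGate Q → FiniteGate Q'
  | .cnot i j h l => .cnot (φ i) (φ j) (fun e => h (φ.injective e)) l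
  | .hadamard i => .hadamard (φ i)
  | .phase i => .phase (φ i)
  | .cphase i j h l => .cphase (φ i) (φ j) (fun e => h (φ.injective e)) l
  | .cphaseSelf i l h => .cphaseSelf (φ i) l h

/-- Relabel the qubits of a gate. -/
def Gate.map (φ : Q ↪ Q') : Gate Q → Gate Q'
  | .finite g => .finite (g.map φ)
  | .infinite i f h => .infinite (φ i) f h

/-- The elementary step of the gate, which is repeated frame after frame, acts on at most `N`
consecutive frames. For the `1/f(D)` operation the step is a set of CNOT gates on
`deg f - del f + 1` consecutive frames. -/
def Gate.ActsWithin (N : ℕ) : Gate Q → Prop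
  | .finite (.cnot _ _ _ l) => |l| < N
  | .finite (.hadamard _) => 0 < N
  | .finite (.phase _) => 0 < N
  | .finite (.cphase _ _ _ l) => |l| < N
  | .finite (.cphaseSelf _ l _) => |l| < N
  | .infinite _ f _ => ∀ p q : ℤ, f.coeff p ≠ 0 → f.coeff q ≠ 0 → p - q < N

/-- A circuit is online if it acts on a bounded number of frames at a time. -/
def IsOnline (C : List (Gate Q)) : Prop := ∃ N : ℕ, ∀ g ∈ C, g.ActsWithin N

end Circuits

/-! ### The unencoded and the encoded qubit stream

In each frame the receiver holds `c` qubits (`Sum.inl`) and the sender holds `n` qubits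
(`Sum.inr`). The sender's qubits are `c` halves of ebits, `a` ancillas and `m` information qubits;
`e` says which of the `n` qubits plays which role. -/

section Streams

variable {n c a m : ℕ}

/-- The qubits of a frame: those of the receiver and those of the sender. -/
abbrev FrameQubits (c n : ℕ) : Type := Fin c ⊕ Fin n

/-- The row of the Pauli operator `Z` on qubit `q`. -/
def rowZ {Q : Type} [DecidableEq Q] (q : Q) : Row Q := Pi.single (Sum.inl q) 1

/-- The row of the Pauli operator `X` on qubit `q`. -/
def rowX {Q : Type} [DecidableEq Q] (q : Q) : Row Q := Pi.single (Sum.inr q) 1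

/-- The stabilizer of the unencoded stream: `ZZ` and `XX` for each ebit, `Z` for each ancilla. -/
def initialStabilizer (e : (Fin c ⊕ Fin a) ⊕ Fin m ≃ Fin n) :
    Matrix (GenIdx c a) (FrameQubits c n ⊕ FrameQubits c n) K :=
  Matrix.of fun
    | Sum.inl (b, i) =>
        if b = 0 then rowZ (Sum.inl i) + rowZ (Sum.inr (e (Sum.inl (Sum.inl i))))
        else rowX (Sum.inl i) + rowX (Sum.inr (e (Sum.inl (Sum.inl i))))
    | Sum.inr j => rowZ (Sum.inr (e (Sum.inl (Sum.inr j))))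

/-- The information-qubit matrix of the unencoded stream: the logical operators `Z` and `X` of each
information qubit. -/
def initialInfo (e : (Fin c ⊕ Fin a) ⊕ Fin m ≃ Fin n) :
    Matrix (Fin 2 × Fin m) (FrameQubits c n ⊕ FrameQubits c n) K :=
  Matrix.of fun r =>
    if r.1 = 0 then rowZ (Sum.inr (e (Sum.inr r.2))) else rowX (Sum.inr (e (Sum.inr r.2)))

/-- The part of a matrix on the sender's qubits. -/
def senderPart {ρ : Type} (M : Matrix ρ (FrameQubits c n ⊕ FrameQubits c n) K) :
    Matrix ρ (Fin n ⊕ Fin n) K :=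
  M.submatrix id (Sum.map Sum.inr Sum.inr)

/-- A circuit of the sender, as a circuit on all qubits of the frame. -/
def onSender (C : List (Gate (Fin n))) : List (Gate (FrameQubits c n)) :=
  C.map (Gate.map Function.Embedding.inr)

/-- The encoding circuit `E`, which acts on the sender's qubits only, encodes the stream into the
code with check matrix `H`: on the sender's qubits, the encoded stabilizer and `H` agree up to row
operations, that is, up to an invertible matrix of rational functions. -/
def Encodes (e : (Fin c ⊕ Fin a) ⊕ Fin m ≃ Fin n) (E : List (Gate (Fin n)))
    (H : Matrix (GenIdx c a) (Fin n ⊕ Fin n) K) : Prop :=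
  ∃ R : Matrix (GenIdx c a) (GenIdx c a) K, IsUnit R ∧
    H = R * senderPart (run (onSender E) (initialStabilizer e))

/-- The decoding circuit `F`, which acts on all qubits of the frame, recovers the information qubits
encoded by `E`: after encoding and decoding, their logical operators have their original form up to
multiplication by (finite products of shifts of) the stabilizer generators. -/
def Decodes (e : (Fin c ⊕ Fin a) ⊕ Fin m ≃ Fin n) (E : List (Gate (Fin n)))
    (F : List (Gate (FrameQubits c n))) : Prop :=
  ∃ L : Matrix (Fin 2 × Fin m) (GenIdx c a) Laurent,
    run F (run (onSender E) (initialInfo e)) =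
      initialInfo e + L.map Laurent.toK * run F (run (onSender E) (initialStabilizer e))

end Streams

end QConv

end

/-!
Over a field of characteristic 2 with an involution (here `f(D) ↦ f(D⁻¹)`), the shifted symplectic
product is a nondegenerate form, and gates act on rows as isometries of it. Together with the
receiver's halves of the ebits, the rows of `H` span an isotropic space of dimension `2c + a` in
the rows over `c + n` qubits, so `2c + a ≤ c + n`, that is, `k + c ≥ 0`.

The decoder determines the logical operators. Every Laurent multiple of a column can be added to a
column of another qubit by finite-depth gates, so the Euclidean algorithm moves a self-orthogonal
row to a multiple of a single `Z` operator. The Euclidean algorithm needs two qubits at least, and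
one qubit after the other it moves the isotropic space off the information qubits (if there are
none, there is nothing to decode). The preimages of the operators of the information qubits have
Laurent polynomial entries, so Laurent multiples of the ebit rows cancel their receiver's parts.
What remains are logical operators on the sender's qubits: hyperbolic pairs that are orthogonal to
`H`.

Infinite-depth gates scale a column by an arbitrary nonzero rational function, and then every
isotropic vector can be moved to a single `Z` operator. As in Witt's theorem, some circuit of the
sender takes the ebit rows of `H` and the logical operators to the standard hyperbolic pairs, and
the remaining rows of `H` to combinations of ancilla rows. The encoder is its inverse.
-/

noncomputable section

namespace QConv

open Polynomial

/-! ### Rows and the shifted symplectic form -/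

section Slots

variable {Q : Type*}

/-- The qubit to which a column of `[z | x]` belongs; the other column of that qubit is
`s.swap`. -/
def qubit : Q ⊕ Q → Q := Sum.elim id id

@[simp]
lemma qubit_swap (s : Q ⊕ Q) : qubit s.swap = qubit s := by
  cases s <;> rfl

lemma qubit_map {ι : Type*} (φ : ι → Q) (s : ι ⊕ ι) : qubit (s.map φ φ) = φ (qubit s) := by
  cases s <;> rfl

lemma swap_ne (s : Q ⊕ Q) : s.swap ≠ s := by
  cases s <;> simp

lemma eq_or_eq_swap_of_qubit_eq {s t : Q ⊕ Q} (h : qubit s = qubit t) : s = t ∨ s = t.swap := by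
  cases s <;> cases t <;> simp_all [qubit]

variable {R : Type*} [CommRing R]

variable (R) in
/-- The rows acting only on the qubits in `T`. -/
def supported (T : Finset Q) : Submodule R (Q ⊕ Q → R) :=
  Submodule.pi {s | qubit s ∉ T} fun _ => ⊥

lemma mem_supported {T : Finset Q} {u : Q ⊕ Q → R} :
    u ∈ supported R T ↔ ∀ s, qubit s ∉ T → u s = 0 := Iff.rfl

lemma supported_mono {T T' : Finset Q} (h : T ⊆ T') : supported R T ≤ supported R T' :=
  fun _ hu s hs => hu s fun hsT => hs (h hsT)

lemma supported_univ [Fintype Q] : supported R (Finset.univ : Finset Q) = ⊤ :=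
  eq_top_iff.2 fun _ _ s hs => absurd (Finset.mem_univ (qubit s)) hs

variable [DecidableEq Q]

lemma single_of_qubit_ne {s t : Q ⊕ Q} (h : qubit s ≠ qubit t) (x : R) :
    (Pi.single s x : Q ⊕ Q → R) t = 0 := by
  rw [Pi.single_eq_of_ne]
  rintro rfl
  exact h rfl

@[simp]
lemma single_apply_swap (s : Q ⊕ Q) (x : R) : (Pi.single s x : Q ⊕ Q → R) s.swap = 0 := by
  rw [Pi.single_eq_of_ne (swap_ne s)]

@[simp]
lemma single_swap_apply (s : Q ⊕ Q) (x : R) : (Pi.single s.swap x : Q ⊕ Q → R) s = 0 := by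
  rw [Pi.single_eq_of_ne (swap_ne s).symm]

lemma single_mem_supported {T : Finset Q} {s : Q ⊕ Q} (hs : qubit s ∈ T) (x : R) :
    Pi.single s x ∈ supported R T :=
  mem_supported.2 fun _ ht => single_of_qubit_ne (fun h => ht (h ▸ hs)) x

end Slots

/-- The invertible column operations on the rows over the qubits `Q`. -/
abbrev RowAut (R Q : Type*) [CommRing R] : Type _ := (Q ⊕ Q → R) ≃ₗ[R] (Q ⊕ Q → R)

section Symplectic

variable {R Q : Type*} [CommRing R] [StarRing R] [Fintype Q]

/-- The shifted symplectic form of two rows `[z | x]`. The second row is conjugated; in the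
application, conjugation is time reversal. -/
def symplecticForm : (Q ⊕ Q → R) →ₗ[R] (Q ⊕ Q → R) →ₗ⋆[R] R :=
  LinearMap.mk₂'ₛₗ (RingHom.id R) (starRingEnd R) (fun u v => ∑ s, u s * star (v s.swap))
    (fun u u' v => by simp only [Pi.add_apply, add_mul, Finset.sum_add_distrib])
    (fun a u v => by
      simp only [Pi.smul_apply, smul_eq_mul, mul_assoc, Finset.mul_sum, RingHom.id_apply])
    (fun u v v' => by simp only [Pi.add_apply, star_add, mul_add, Finset.sum_add_distrib])
    (fun a u v => by
      simp only [Pi.smul_apply, smul_eq_mul, star_mul', Finset.mul_sum, mul_left_comm,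
        starRingEnd_apply])

lemma symplecticForm_apply (u v : Q ⊕ Q → R) :
    symplecticForm u v = ∑ s, u s * star (v s.swap) := rfl

lemma star_symplecticForm (u v : Q ⊕ Q → R) : star (symplecticForm u v) = symplecticForm v u := by
  rw [symplecticForm_apply, symplecticForm_apply, star_sum,
    ← (Equiv.sumComm Q Q).sum_comp fun s => v s * star (u s.swap)]
  simp [mul_comm]

lemma symplecticForm_isRefl : (symplecticForm (R := R) (Q := Q)).IsRefl := fun u v h => by
  rw [← star_symplecticForm, h, star_zero]

variable [DecidableEq Q]

@[simp]
lemma symplecticForm_single_left (s : Q ⊕ Q) (x : R) (v : Q ⊕ Q → R) :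
    symplecticForm (Pi.single s x) v = x * star (v s.swap) := by
  simp [symplecticForm_apply, Pi.single_apply]

@[simp]
lemma symplecticForm_single_right (s : Q ⊕ Q) (x : R) (u : Q ⊕ Q → R) :
    symplecticForm u (Pi.single s x) = u s.swap * star x := by
  rw [← star_symplecticForm, symplecticForm_single_left, star_mul', star_star, mul_comm]

/-- The isometries of the symplectic form that act on the qubits in `T` only. -/
def localIsometryGroup (T : Finset Q) : Subgroup (RowAut R Q) where
  carrier := {g | (∀ u v, symplecticForm (g u) (g v) = symplecticForm u v) ∧
    ∀ u ∈ supported R Tᶜ, g u = u}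
  one_mem' := ⟨fun _ _ => rfl, fun _ _ => rfl⟩
  mul_mem' {g h} hg hh := by
    refine ⟨fun u v => ?_, fun u hu => ?_⟩
    · rw [LinearEquiv.mul_apply, LinearEquiv.mul_apply, hg.1, hh.1]
    · rw [LinearEquiv.mul_apply, hh.2 u hu, hg.2 u hu]
  inv_mem' {g} hg := by
    refine ⟨fun u v => ?_, fun u hu => ?_⟩
    · rw [← hg.1, ← LinearEquiv.mul_apply, ← LinearEquiv.mul_apply, mul_inv_cancel]
      rfl
    · exact g.symm_apply_eq.2 (hg.2 u hu).symm

lemma apply_mem_supported {T : Finset Q} {g : RowAut R Q}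
    (hg : g ∈ localIsometryGroup T) {u : Q ⊕ Q → R} (hu : u ∈ supported R T) :
    g u ∈ supported R T := by
  intro s hs
  have hfix : g (Pi.single s.swap 1) = Pi.single s.swap 1 :=
    hg.2 _ (single_mem_supported (by simpa using hs) 1)
  have h : symplecticForm (g u) (g (Pi.single s.swap 1)) = symplecticForm u (Pi.single s.swap 1) :=
    hg.1 _ _
  simpa [hfix, mem_supported.1 hu s hs] using h

end Symplectic

/-! ### Transvections, Eichler transformations and scalings -/

section Elementary

variable {R Q : Type*} [CommRing R] [CharP R 2]

lemma row_add_self (u : Q ⊕ Q → R) : u + u = 0 := funext fun _ => CharTwo.add_self_eq_zero _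

variable [DecidableEq Q]

/-- The symplectic transvection adding `p` times column `s` to column `s.swap`. It is an isometry
if `p` is self-adjoint, and generalizes the phase gates. -/
def transvection (s : Q ⊕ Q) (p : R) : RowAut R Q :=
  LinearEquiv.ofInvolutive
    (LinearMap.id + (LinearMap.single R (fun _ => R) s.swap).comp (p • LinearMap.proj s))
    fun u => by
      ext t
      simp only [LinearMap.add_apply, LinearMap.id_apply, LinearMap.comp_apply,
        LinearMap.smul_apply, LinearMap.proj_apply, LinearMap.single_apply, Pi.add_apply,
        single_swap_apply, smul_eq_mul, add_zero]
      rw [add_assoc, CharTwo.add_self_eq_zero, add_zero]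

lemma transvection_apply (s : Q ⊕ Q) (p : R) (u : Q ⊕ Q → R) :
    transvection s p u = u + Pi.single s.swap (p * u s) := rfl

lemma inv_transvection (s : Q ⊕ Q) (p : R) : (transvection s p)⁻¹ = transvection s p := rfl

variable [StarRing R]

/-- The Eichler transformation from column `s` to a column `s'` of another qubit. It generalizes the
CNOT gate if `s` and `s'` are both `x` columns, and the controlled-phase gate if only `s` is. -/
def eichler (s s' : Q ⊕ Q) (h : qubit s ≠ qubit s') (f : R) : RowAut R Q :=
  LinearEquiv.ofInvolutive
    (LinearMap.id + (LinearMap.single R (fun _ => R) s').comp (f • LinearMap.proj s) +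
      (LinearMap.single R (fun _ => R) s.swap).comp (star f • LinearMap.proj s'.swap))
    fun u => by
      have h' : qubit s.swap ≠ qubit s'.swap := by simpa using h
      ext t
      simp only [LinearMap.add_apply, LinearMap.id_apply, LinearMap.comp_apply,
        LinearMap.smul_apply, LinearMap.proj_apply, LinearMap.single_apply, Pi.add_apply,
        single_of_qubit_ne h.symm, single_of_qubit_ne h', single_swap_apply, single_apply_swap,
        smul_eq_mul, add_zero]
      linear_combination (Pi.single (M := fun _ => R) s' (f * u s) t +
        Pi.single (M := fun _ => R) s.swap (star f * u s'.swap) t) * CharTwo.two_eq_zero (R := R)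

lemma eichler_apply (s s' : Q ⊕ Q) (h : qubit s ≠ qubit s') (f : R) (u : Q ⊕ Q → R) :
    eichler s s' h f u =
      u + Pi.single s' (f * u s) + Pi.single s.swap (star f * u s'.swap) := rfl

lemma inv_eichler (s s' : Q ⊕ Q) (h : qubit s ≠ qubit s') (f : R) :
    (eichler s s' h f)⁻¹ = eichler s s' h f := rfl

/-- The group generated by the Eichler transformations and the transvections on the qubits in `T`
with coefficients in `A`. -/
def elementaryGroup (A : Subring R) (T : Finset Q) : Subgroup (RowAut R Q) :=
  Subgroup.closure
    ({g | ∃ s s' h, ∃ f ∈ A, qubit s ∈ T ∧ qubit s' ∈ T ∧ g = eichler s s' h f} ∪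
      {g | ∃ s, ∃ p ∈ A, star p = p ∧ qubit s ∈ T ∧ g = transvection s p})

lemma eichler_mem_elementaryGroup {A : Subring R} {T : Finset Q} {s s' : Q ⊕ Q}
    (h : qubit s ≠ qubit s') {f : R} (hf : f ∈ A) (hs : qubit s ∈ T) (hs' : qubit s' ∈ T) :
    eichler s s' h f ∈ elementaryGroup A T :=
  Subgroup.subset_closure (Or.inl ⟨s, s', h, f, hf, hs, hs', rfl⟩)

lemma transvection_mem_elementaryGroup {A : Subring R} {T : Finset Q} {s : Q ⊕ Q} {p : R}
    (hp : p ∈ A) (hstar : star p = p) (hs : qubit s ∈ T) :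
    transvection s p ∈ elementaryGroup A T :=
  Subgroup.subset_closure (Or.inr ⟨s, p, hp, hstar, hs, rfl⟩)

lemma elementaryGroup_toSubmonoid_le {A : Subring R} {T : Finset Q} {M : Submonoid (RowAut R Q)}
    (h_eichler : ∀ s s' h, ∀ f ∈ A, qubit s ∈ T → qubit s' ∈ T → eichler s s' h f ∈ M)
    (h_transvection : ∀ s, ∀ p ∈ A, star p = p → qubit s ∈ T → transvection s p ∈ M) :
    (elementaryGroup A T).toSubmonoid ≤ M := by
  rw [elementaryGroup, Subgroup.closure_toSubmonoid, Submonoid.closure_le, Set.union_inv]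
  refine Set.union_subset (Set.union_subset ?_ ?_) (Set.union_subset ?_ ?_)
  · rintro _ ⟨s, s', h, f, hf, hs, hs', rfl⟩
    exact h_eichler s s' h f hf hs hs'
  · rintro _ ⟨s, p, hp, hstar, hs, rfl⟩
    exact h_transvection s p hp hstar hs
  · rintro g ⟨s, s', h, f, hf, hs, hs', hg⟩
    rw [← inv_inv g, hg, inv_eichler]
    exact h_eichler s s' h f hf hs hs'
  · rintro g ⟨s, p, hp, hstar, hs, hg⟩
    rw [← inv_inv g, hg, inv_transvection]
    exact h_transvection s p hp hstar hs

lemma elementaryGroup_mono {A : Subring R} {T T' : Finset Q} (hT : T ⊆ T') :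
    elementaryGroup A T ≤ elementaryGroup A T' :=
  elementaryGroup_toSubmonoid_le
    (fun _ _ h _ hf hs hs' => eichler_mem_elementaryGroup h hf (hT hs) (hT hs'))
    (fun _ _ hp hstar hs => transvection_mem_elementaryGroup hp hstar (hT hs))

lemma elementaryGroup_apply_mem {A : Subring R} (hA : ∀ x ∈ A, star x ∈ A) {T : Finset Q}
    {g : RowAut R Q} (hg : g ∈ elementaryGroup A T) {u : Q ⊕ Q → R} (hu : ∀ t, u t ∈ A)
    (t : Q ⊕ Q) : g u t ∈ A := by
  have single_mem (s t : Q ⊕ Q) {x : R} (hx : x ∈ A) :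
      (Pi.single s x : Q ⊕ Q → R) t ∈ A := by
    rw [Pi.single_apply]
    split
    exacts [hx, A.zero_mem]
  let M : Submonoid (RowAut R Q) :=
    { carrier := {g | ∀ u : Q ⊕ Q → R, (∀ t, u t ∈ A) → ∀ t, g u t ∈ A}
      one_mem' := fun _ hu => hu
      mul_mem' := fun hg hh u hu => hg _ (hh u hu) }
  refine elementaryGroup_toSubmonoid_le (M := M) ?_ ?_ hg u hu t
  · intro s s' _ f hf _ _ u hu t
    exact add_mem (add_mem (hu t) (single_mem _ _ (mul_mem hf (hu s))))
      (single_mem _ _ (mul_mem (hA f hf) (hu s'.swap)))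
  · intro s p hp _ _ u hu t
    exact add_mem (hu t) (single_mem _ _ (mul_mem hp (hu s)))

variable [Fintype Q]

lemma eichler_mem_localIsometryGroup {T : Finset Q} {s s' : Q ⊕ Q} (h : qubit s ≠ qubit s') (f : R)
    (hs : qubit s ∈ T) (hs' : qubit s' ∈ T) : eichler s s' h f ∈ localIsometryGroup T := by
  have h' : qubit s.swap ≠ qubit s'.swap := by simpa using h
  refine ⟨fun u v => ?_, fun u hu => ?_⟩
  · have h_add : symplecticForm (eichler s s' h f u) (eichler s s' h f v) = symplecticForm u v +
        2 * (f * u s * star (v s'.swap) + star f * u s'.swap * star (v s)) := by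
      simp only [eichler_apply, map_add, LinearMap.add_apply, symplecticForm_single_left,
        symplecticForm_single_right, Sum.swap_swap, star_mul', star_star, single_apply_swap,
        single_swap_apply, single_of_qubit_ne h.symm, single_of_qubit_ne h']
      ring
    rw [h_add, CharTwo.two_eq_zero, zero_mul, add_zero]
  · have hus := mem_supported.1 hu s (by simpa using hs)
    have hus' := mem_supported.1 hu s'.swap (by simpa using hs')
    simp [eichler_apply, hus, hus']

lemma transvection_mem_localIsometryGroup {T : Finset Q} {s : Q ⊕ Q} {p : R} (hp : star p = p)
    (hs : qubit s ∈ T) : transvection s p ∈ localIsometryGroup T := by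
  refine ⟨fun u v => ?_, fun u hu => ?_⟩
  · have h_add : symplecticForm (transvection s p u) (transvection s p v) = symplecticForm u v +
        2 * (p * u s * star (v s)) := by
      simp only [transvection_apply, map_add, LinearMap.add_apply, symplecticForm_single_left,
        symplecticForm_single_right, Sum.swap_swap, star_mul', hp, single_swap_apply]
      ring
    rw [h_add, CharTwo.two_eq_zero, zero_mul, add_zero]
  · simp [transvection_apply, mem_supported.1 hu s (by simpa using hs)]

lemma elementaryGroup_le_localIsometryGroup (A : Subring R) (T : Finset Q) :
    elementaryGroup A T ≤ localIsometryGroup T :=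
  elementaryGroup_toSubmonoid_le (M := (localIsometryGroup T).toSubmonoid)
    (fun _ _ h f _ hs hs' => eichler_mem_localIsometryGroup h f hs hs')
    (fun _ _ _ hstar hs => transvection_mem_localIsometryGroup hstar hs)

end Elementary

section Transitive

variable {R Q : Type*} [CommRing R] [StarRing R] [CharP R 2] [DecidableEq Q] {A : Subring R}
  {T : Finset Q}

lemma exists_map_single_eq_single {s t : Q ⊕ Q} (hs : qubit s ∈ T) (ht : qubit t ∈ T) :
    ∃ g ∈ elementaryGroup A T, g (Pi.single s 1) = Pi.single t (1 : R) := by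
  by_cases h : qubit s = qubit t
  · rcases eq_or_eq_swap_of_qubit_eq h with rfl | rfl
    · exact ⟨1, one_mem _, rfl⟩
    · refine ⟨transvection t 1 * transvection t.swap 1,
        mul_mem (transvection_mem_elementaryGroup A.one_mem (star_one R) ht)
          (transvection_mem_elementaryGroup A.one_mem (star_one R) hs), ?_⟩
      simp only [LinearEquiv.mul_apply, transvection_apply, Sum.swap_swap, Pi.add_apply,
        Pi.single_eq_same, single_swap_apply, mul_one, zero_add]
      rw [add_right_comm, row_add_self, zero_add]
  · refine ⟨eichler t s (Ne.symm h) 1 * eichler s t h 1,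
      mul_mem (eichler_mem_elementaryGroup _ A.one_mem ht hs)
        (eichler_mem_elementaryGroup _ A.one_mem hs ht), ?_⟩
    have h' : qubit s ≠ qubit t.swap := by simpa using h
    have h'' : qubit t ≠ qubit s.swap := by simpa using Ne.symm h
    simp only [LinearEquiv.mul_apply, eichler_apply, Pi.add_apply, Pi.single_eq_same,
      single_of_qubit_ne h, single_of_qubit_ne h', single_of_qubit_ne h'', single_apply_swap,
      mul_one, mul_zero, Pi.single_zero, add_zero, zero_add]
    rw [add_right_comm, row_add_self, zero_add]

/-- Column operations with source `s` change, apart from their target, only column `s.swap`, so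
they can be used to clear any set of columns one by one. -/
lemma exists_clear_columns {s : Q ⊕ Q} (hs : qubit s ∈ T) {u : Q ⊕ Q → R} (huA : ∀ t, u t ∈ A)
    (huT : u ∈ supported R T) (hus : u s = 1) (W : Finset (Q ⊕ Q))
    (hW : ∀ t ∈ W, qubit s ≠ qubit t) :
    ∃ g ∈ elementaryGroup A T, g (Pi.single s.swap 1) = Pi.single s.swap 1 ∧
      ∀ t ≠ s.swap, g u t = if t ∈ W then 0 else u t := by
  induction W using Finset.induction_on with
  | empty => exact ⟨1, one_mem _, rfl, fun _ _ => rfl⟩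
  | insert r W hr ih =>
    obtain ⟨g, hg, hfix, hgu⟩ := ih fun t ht => hW t (Finset.mem_insert_of_mem ht)
    have hsW : s ∉ W := fun hs => hW s (Finset.mem_insert_of_mem hs) rfl
    have hsr : qubit s ≠ qubit r := hW r (Finset.mem_insert_self _ _)
    by_cases hrT : qubit r ∈ T
    · refine ⟨eichler s r hsr (u r) * g,
        mul_mem (eichler_mem_elementaryGroup _ (huA r) hs hrT) hg, ?_, fun t ht => ?_⟩
      · rw [LinearEquiv.mul_apply, hfix, eichler_apply, single_swap_apply,
          single_of_qubit_ne (by simpa using hsr)]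
        simp
      · have hgus : g u s = 1 := by rw [hgu s (swap_ne s).symm, if_neg hsW, hus]
        rw [LinearEquiv.mul_apply, eichler_apply, hgus, mul_one, Pi.add_apply, Pi.add_apply,
          Pi.single_eq_of_ne ht, add_zero, hgu t ht]
        rcases eq_or_ne t r with rfl | htr
        · simp [hr, CharTwo.add_self_eq_zero]
        · simp [htr]
    · refine ⟨g, hg, hfix, fun t ht => ?_⟩
      rcases eq_or_ne t r with rfl | htr
      · simp [hgu t ht, mem_supported.1 huT t hrT]
      · simp [hgu t ht, htr]

variable [Fintype Q]

lemma exists_map_eq_single_of_apply_eq_one (hA : ∀ x ∈ A, star x ∈ A) {s : Q ⊕ Q}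
    (hs : qubit s ∈ T) {u : Q ⊕ Q → R} (huA : ∀ t, u t ∈ A) (huT : u ∈ supported R T)
    (hus : u s = 1) (hu : symplecticForm u u = 0) :
    ∃ g ∈ elementaryGroup A T,
      g u = Pi.single s 1 ∧ g (Pi.single s.swap 1) = Pi.single s.swap 1 := by
  obtain ⟨g, hg, hfix, hgu⟩ := exists_clear_columns hs huA huT hus
    ({t | qubit s ≠ qubit t} : Finset (Q ⊕ Q)) (by simp)
  obtain ⟨x, hx⟩ : ∃ x, g u = Pi.single s 1 + Pi.single s.swap x := by
    refine ⟨g u s.swap, ?_⟩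
    have hgus : g u s = 1 := by simp [hgu s (swap_ne s).symm, hus]
    ext t
    by_cases ht : qubit s = qubit t
    · rcases eq_or_eq_swap_of_qubit_eq ht.symm with rfl | rfl
      · simp [hgus]
      · simp
    · have ht' : qubit s.swap ≠ qubit t := by simpa using ht
      have hts : t ≠ s.swap := by rintro rfl; exact ht' rfl
      simp [hgu t hts, ht, single_of_qubit_ne ht, single_of_qubit_ne ht']
  have hxA : x ∈ A := by
    have h := elementaryGroup_apply_mem hA hg huA s.swap
    simpa [hx] using h
  have hxstar : star x = x := by
    have h := (elementaryGroup_le_localIsometryGroup A T hg).1 u u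
    simp only [hu, hx, map_add, LinearMap.add_apply, symplecticForm_single_right,
      Pi.single_eq_same, single_apply_swap, single_swap_apply, star_one, mul_one,
      one_mul, Sum.swap_swap, zero_mul, zero_add, add_zero] at h
    exact (CharTwo.add_eq_zero.1 h).symm
  refine ⟨transvection s x * g, mul_mem (transvection_mem_elementaryGroup hxA hxstar hs) hg, ?_, ?_⟩
  · rw [LinearEquiv.mul_apply, hx, transvection_apply]
    simp only [Pi.add_apply, Pi.single_eq_same, single_swap_apply, add_zero, mul_one]
    rw [add_assoc, row_add_self, add_zero]
  · rw [LinearEquiv.mul_apply, hfix, transvection_apply, single_swap_apply, mul_zero,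
      Pi.single_zero, add_zero]

lemma exists_map_eq_single (hA : ∀ x ∈ A, star x ∈ A) {s t : Q ⊕ Q} (hs : qubit s ∈ T)
    (htT : qubit t ∈ T) {u : Q ⊕ Q → R} (huA : ∀ t, u t ∈ A) (huT : u ∈ supported R T)
    (ht : u t = 1) (hu : symplecticForm u u = 0) :
    ∃ g ∈ elementaryGroup A T, g u = Pi.single s 1 := by
  obtain ⟨g, hg, hgu, -⟩ := exists_map_eq_single_of_apply_eq_one hA htT huA huT ht hu
  obtain ⟨h, hh, hht⟩ := exists_map_single_eq_single (A := A) (R := R) htT hs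
  exact ⟨h * g, mul_mem hh hg, by rw [LinearEquiv.mul_apply, hgu, hht]⟩

end Transitive

section Scaling

variable {R Q : Type*} [CommRing R] [StarRing R] [DecidableEq Q]

/-- The scaling of column `s` by a unit `f` and of its partner `s.swap` by `(star f)⁻¹`, the
generalization of the infinite-depth gates. -/
def scaling (s : Q ⊕ Q) : Rˣ →* RowAut R Q where
  toFun f := LinearEquiv.piCongrRight fun t =>
    DistribMulAction.toLinearEquiv R R (if t = s then f else if t = s.swap then (star f)⁻¹ else 1)
  map_one' := by
    ext u t
    simp
  map_mul' f f' := by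
    ext1 u
    ext t
    simp only [LinearEquiv.mul_apply, LinearEquiv.piCongrRight_apply,
      DistribMulAction.toLinearEquiv_apply, smul_smul]
    split_ifs <;> simp [star_mul', mul_comm]

lemma scaling_apply (s : Q ⊕ Q) (f : Rˣ) (u : Q ⊕ Q → R) (t : Q ⊕ Q) :
    scaling s f u t =
      (if t = s then f else if t = s.swap then (star f)⁻¹ else 1 : Rˣ) * u t := rfl

variable [Fintype Q]

lemma scaling_mem_localIsometryGroup {T : Finset Q} {s : Q ⊕ Q} (hs : qubit s ∈ T) (f : Rˣ) :
    scaling s f ∈ localIsometryGroup T := by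
  refine ⟨fun u v => Finset.sum_congr rfl fun t _ => ?_, fun u hu => ?_⟩
  · have h_coeff : ((if t = s then f else if t = s.swap then (star f)⁻¹ else 1 : Rˣ) : R) *
        star ((if t.swap = s then f else if t.swap = s.swap then (star f)⁻¹ else 1 : Rˣ) : R) =
          1 := by
      rcases eq_or_ne t s with rfl | hts
      · simp [swap_ne]
      rcases eq_or_ne t s.swap with rfl | hts'
      · simp [swap_ne, ← star_mul']
      have hst : t.swap ≠ s := by rintro rfl; simp at hts'
      simp [hts, hts', hst, Sum.swap_rightInverse.injective.ne hts]
    rw [scaling_apply, scaling_apply, star_mul', mul_mul_mul_comm, h_coeff, one_mul]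
  · ext t
    by_cases ht : qubit t = qubit s
    · rw [scaling_apply, mem_supported.1 hu t (by simpa [ht] using hs), mul_zero]
    · have hts : t ≠ s := by rintro rfl; exact ht rfl
      have hts' : t ≠ s.swap := by rintro rfl; exact ht (qubit_swap s)
      rw [scaling_apply, if_neg hts, if_neg hts', Units.val_one, one_mul]

end Scaling

section Clifford

variable {R Q : Type*} [CommRing R] [StarRing R] [CharP R 2] [DecidableEq Q]

variable (R) in
/-- The group generated by the elementary column operations and the scalings on the qubits in
`T`. -/
def cliffordGroup (T : Finset Q) : Subgroup (RowAut R Q) :=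
  elementaryGroup ⊤ T ⊔ Subgroup.closure {g | ∃ s f, qubit s ∈ T ∧ g = scaling s f}

lemma elementaryGroup_le_cliffordGroup (T : Finset Q) :
    elementaryGroup ⊤ T ≤ cliffordGroup R T := le_sup_left

lemma scaling_mem_cliffordGroup {T : Finset Q} {s : Q ⊕ Q} (hs : qubit s ∈ T) (f : Rˣ) :
    scaling s f ∈ cliffordGroup R T :=
  le_sup_right (a := elementaryGroup ⊤ T) (Subgroup.subset_closure ⟨s, f, hs, rfl⟩)

lemma cliffordGroup_mono {T T' : Finset Q} (hT : T ⊆ T') :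
    cliffordGroup R T ≤ cliffordGroup R T' := by
  refine sup_le_sup (elementaryGroup_mono hT) (Subgroup.closure_mono ?_)
  rintro _ ⟨s, f, hs, rfl⟩
  exact ⟨s, f, hT hs, rfl⟩

lemma cliffordGroup_le_localIsometryGroup [Fintype Q] (T : Finset Q) :
    cliffordGroup R T ≤ localIsometryGroup T := by
  refine sup_le (elementaryGroup_le_localIsometryGroup ⊤ T) ((Subgroup.closure_le _).2 ?_)
  rintro _ ⟨s, f, hs, rfl⟩
  exact scaling_mem_localIsometryGroup hs f

variable {F : Type*} [Field F] [StarRing F] [CharP F 2] [Fintype Q]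

lemma exists_mem_cliffordGroup_map_eq_single {T : Finset Q} {s : Q ⊕ Q} (hs : qubit s ∈ T)
    {u : Q ⊕ Q → F} (huT : u ∈ supported F T) (hu0 : u ≠ 0) (hu : symplecticForm u u = 0) :
    ∃ g ∈ cliffordGroup F T, g u = Pi.single s 1 := by
  obtain ⟨t, ht⟩ := Function.ne_iff.1 hu0
  have htT : qubit t ∈ T := by
    by_contra htT
    exact ht (mem_supported.1 huT t htT)
  set g : RowAut F Q := scaling t (Units.mk0 (u t) ht)⁻¹
  have hg := scaling_mem_cliffordGroup htT (Units.mk0 (u t) ht)⁻¹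
  have hgl := cliffordGroup_le_localIsometryGroup T hg
  have hgut : g u t = 1 := by
    rw [scaling_apply, if_pos rfl, Units.val_inv_eq_inv_val, Units.val_mk0, inv_mul_cancel₀ ht]
  obtain ⟨h, hh, hhu⟩ := exists_map_eq_single (A := ⊤) (fun _ _ => Subring.mem_top _) hs htT
    (fun _ => Subring.mem_top _) (apply_mem_supported hgl huT) hgut (by rw [hgl.1, hu])
  exact ⟨h * g, mul_mem (elementaryGroup_le_cliffordGroup T hh) hg, hhu⟩

end Clifford

/-! ### The Euclidean algorithm on rows -/

section Euclidean

variable {F Q : Type*} [CommRing F] [StarRing F] [CharP F 2] [DecidableEq Q] {A : Subring F}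
  {size : F → ℕ}

/-- An entry of least size divides the entries of all other qubits: otherwise, an Eichler
transformation would replace one of them by a smaller remainder. -/
lemma exists_eq_mul_of_size_minimal
    (hdiv : ∀ x ∈ A, ∀ b ∈ A, b ≠ 0 → ∃ q ∈ A, x + q * b = 0 ∨ size (x + q * b) < size b)
    {T : Finset Q} {w : Q ⊕ Q → F} (hwA : ∀ t, w t ∈ A) {t t' : Q ⊕ Q} (ht : qubit t ∈ T)
    (ht' : qubit t' ∈ T) (htt' : qubit t ≠ qubit t') (hwt : w t ≠ 0)
    (hmin : ∀ g ∈ elementaryGroup A T, ∀ r, g w r ≠ 0 → size (w t) ≤ size (g w r)) :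
    ∃ q ∈ A, w t' = q * w t := by
  obtain ⟨q, hq, hrem⟩ := hdiv (w t') (hwA t') (w t) (hwA t) hwt
  have h_eval : eichler t t' htt' q w t' = w t' + q * w t := by
    rw [eichler_apply, Pi.add_apply, Pi.add_apply, Pi.single_eq_same,
      single_of_qubit_ne (by simpa using htt'), add_zero]
  refine ⟨q, hq, CharTwo.add_eq_zero.1 ?_⟩
  by_contra hne
  have hle := hmin _ (eichler_mem_elementaryGroup htt' hq ht ht') t' (by rwa [h_eval])
  rw [h_eval] at hle
  exact (hrem.resolve_left hne).not_ge hle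

/-- An entry of least size divides its partner: adding the partner to a column of another qubit
reduces this to the entries of other qubits. -/
lemma exists_swap_eq_mul_of_size_minimal (hA : ∀ x ∈ A, star x ∈ A)
    (hdiv : ∀ x ∈ A, ∀ b ∈ A, b ≠ 0 → ∃ q ∈ A, x + q * b = 0 ∨ size (x + q * b) < size b)
    {T : Finset Q} {w : Q ⊕ Q → F} (hwA : ∀ t, w t ∈ A) {t r : Q ⊕ Q} (ht : qubit t ∈ T)
    (hr : qubit r ∈ T) (htr : qubit t ≠ qubit r) (hwt : w t ≠ 0)
    (hmin : ∀ g ∈ elementaryGroup A T, ∀ s, g w s ≠ 0 → size (w t) ≤ size (g w s)) :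
    ∃ q ∈ A, w t.swap = q * w t := by
  have htr' : qubit t ≠ qubit r.swap := by simpa using htr
  have ht'r : qubit t.swap ≠ qubit r := by simpa using htr
  have ht'r' : qubit t.swap ≠ qubit r.swap := by simpa using htr
  obtain ⟨q, hq, hwr'⟩ := exists_eq_mul_of_size_minimal hdiv hwA ht
    (by simpa using hr : qubit r.swap ∈ T) htr' hwt hmin
  obtain ⟨q', hq', hwr⟩ := exists_eq_mul_of_size_minimal hdiv hwA ht hr htr hwt hmin
  set g : RowAut F Q := eichler t.swap r ht'r 1 * eichler t r.swap htr' q with hg_def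
  have hg : g ∈ elementaryGroup A T := mul_mem
    (eichler_mem_elementaryGroup _ A.one_mem (by simpa using ht) hr)
    (eichler_mem_elementaryGroup _ hq ht (by simpa using hr))
  have hgt : g w t = w t := by
    simp only [hg_def, LinearEquiv.mul_apply, eichler_apply, Pi.add_apply, Sum.swap_swap,
      Pi.single_eq_same, single_swap_apply, single_of_qubit_ne htr'.symm,
      single_of_qubit_ne htr.symm, single_of_qubit_ne ht'r', hwr', star_one]
    linear_combination q * w t * CharTwo.two_eq_zero (R := F)
  have hgr : g w r = w r + (w t.swap + star q * w r) := by
    simp only [hg_def, LinearEquiv.mul_apply, eichler_apply, Pi.add_apply, Sum.swap_swap,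
      Pi.single_eq_same, single_swap_apply, single_of_qubit_ne htr, single_of_qubit_ne ht'r,
      single_of_qubit_ne ht'r'.symm]
    ring
  obtain ⟨q'', hq'', hgr'⟩ := exists_eq_mul_of_size_minimal hdiv
    (elementaryGroup_apply_mem hA hg hwA) ht hr htr (hgt ▸ hwt) fun h hh s hs => by
      rw [hgt]
      exact hmin (h * g) (mul_mem hh hg) s hs
  refine ⟨q'' + q' + star q * q', add_mem (add_mem hq'' hq') (mul_mem (hA q hq) hq'), ?_⟩
  rw [hgr, hgt, hwr] at hgr'
  linear_combination hgr' - (q' * w t + star q * q' * w t) * CharTwo.two_eq_zero (R := F)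

lemma exists_map_entry_dvd (hA : ∀ x ∈ A, star x ∈ A)
    (hdiv : ∀ x ∈ A, ∀ b ∈ A, b ≠ 0 → ∃ q ∈ A, x + q * b = 0 ∨ size (x + q * b) < size b)
    [Finite Q] {T : Finset Q} (hT : 1 < T.card) {v : Q ⊕ Q → F} (hvA : ∀ t, v t ∈ A)
    (hvT : v ∈ supported F T) (hv0 : v ≠ 0) :
    ∃ g ∈ elementaryGroup A T, ∃ t, qubit t ∈ T ∧ g v t ≠ 0 ∧
      ∀ t', ∃ q ∈ A, g v t' = q * g v t := by
  have := Fintype.ofFinite Q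
  obtain ⟨t₀, ht₀⟩ := Function.ne_iff.1 hv0
  obtain ⟨⟨g, t⟩, ⟨hg, hgt⟩, hmin⟩ := exists_minimalFor_of_wellFoundedLT
    (fun i : RowAut F Q × (Q ⊕ Q) => i.1 ∈ elementaryGroup A T ∧ i.1 v i.2 ≠ 0)
    (fun i => size (i.1 v i.2)) ⟨(1, t₀), one_mem _, ht₀⟩
  have hmin' : ∀ h ∈ elementaryGroup A T, ∀ s, h (g v) s ≠ 0 → size (g v t) ≤ size (h (g v) s) :=
    fun h hh s hs => (le_total _ _).elim id (hmin (j := (h * g, s)) ⟨mul_mem hh hg, hs⟩)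
  have hgvA := elementaryGroup_apply_mem hA hg hvA
  have hgvT := apply_mem_supported (elementaryGroup_le_localIsometryGroup A T hg) hvT
  have htT : qubit t ∈ T := by
    by_contra htT
    exact hgt (mem_supported.1 hgvT t htT)
  refine ⟨g, hg, t, htT, hgt, fun t' => ?_⟩
  by_cases ht' : qubit t' ∈ T
  · by_cases htt' : qubit t = qubit t'
    · rcases eq_or_eq_swap_of_qubit_eq htt'.symm with rfl | rfl
      · exact ⟨1, A.one_mem, (one_mul _).symm⟩
      · obtain ⟨q, hq, hqt⟩ := Finset.exists_mem_ne hT (qubit t)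
        exact exists_swap_eq_mul_of_size_minimal hA hdiv hgvA htT (r := Sum.inl q) hq hqt.symm hgt
          hmin'
    · exact exists_eq_mul_of_size_minimal hdiv hgvA htT ht' htt' hgt hmin'
  · exact ⟨0, A.zero_mem, by rw [mem_supported.1 hgvT t' ht', zero_mul]⟩

end Euclidean

section EuclideanField

variable {F Q : Type*} [Field F] [StarRing F] [CharP F 2] [DecidableEq Q] [Fintype Q]
  {A : Subring F} {size : F → ℕ}

lemma exists_mem_elementaryGroup_map_eq_smul_single (hA : ∀ x ∈ A, star x ∈ A)
    (hdiv : ∀ x ∈ A, ∀ b ∈ A, b ≠ 0 → ∃ q ∈ A, x + q * b = 0 ∨ size (x + q * b) < size b)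
    (hden : ∀ u : Q ⊕ Q → F, ∃ d : F, d ≠ 0 ∧ ∀ t, d * u t ∈ A) {T : Finset Q}
    (hT : 1 < T.card) {s : Q ⊕ Q} (hs : qubit s ∈ T) {v : Q ⊕ Q → F} (hvT : v ∈ supported F T)
    (hv : symplecticForm v v = 0) :
    ∃ g ∈ elementaryGroup A T, ∃ a : F, g v = a • Pi.single s 1 := by
  rcases eq_or_ne v 0 with rfl | hv0
  · exact ⟨1, one_mem _, 0, by simp⟩
  obtain ⟨d, hd0, hd⟩ := hden v
  obtain ⟨g, hg, t, htT, hgt, hgdvd⟩ := exists_map_entry_dvd hA hdiv hT (v := d • v) hd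
    (Submodule.smul_mem _ d hvT) (smul_ne_zero hd0 hv0)
  have hgl := elementaryGroup_le_localIsometryGroup A T hg
  have hgT := apply_mem_supported hgl (Submodule.smul_mem _ d hvT)
  set b := g (d • v) t
  have huA : ∀ t', (b⁻¹ • g (d • v)) t' ∈ A := fun t' => by
    obtain ⟨q, hq, hqt'⟩ := hgdvd t'
    rwa [Pi.smul_apply, smul_eq_mul, hqt', mul_comm, mul_inv_cancel_right₀ hgt]
  have hu : symplecticForm (b⁻¹ • g (d • v)) (b⁻¹ • g (d • v)) = 0 := by
    simp [hgl.1, hv]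
  obtain ⟨h, hh, hhy⟩ := exists_map_eq_single hA hs htT huA (Submodule.smul_mem _ _ hgT)
    (inv_mul_cancel₀ hgt) hu
  refine ⟨h * g, mul_mem hh hg, d⁻¹ * b, ?_⟩
  rw [LinearEquiv.mul_apply, mul_smul, ← hhy, map_smul, smul_inv_smul₀ hgt, map_smul, map_smul,
    inv_smul_smul₀ hd0]

end EuclideanField

/-! ### Isotropic subspaces and symplectic bases -/

section Witt

variable {F Q : Type*} [Field F] [DecidableEq Q]

lemma mem_supported_erase {T : Finset Q} {s : Q ⊕ Q} {u : Q ⊕ Q → F} (hu : u ∈ supported F T)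
    (hus : u s = 0) (hus' : u s.swap = 0) : u ∈ supported F (T.erase (qubit s)) := by
  intro t ht
  by_cases hts : qubit t = qubit s
  · rcases eq_or_eq_swap_of_qubit_eq hts with rfl | rfl
    exacts [hus, hus']
  · exact hu t fun htT => ht (Finset.mem_erase.2 ⟨hts, htT⟩)

lemma finrank_inf_ker_proj_lt [Finite Q] {S : Submodule F (Q ⊕ Q → F)} {s : Q ⊕ Q}
    (hs : Pi.single s 1 ∈ S) :
    Module.finrank F ↑(S ⊓ LinearMap.ker (LinearMap.proj (φ := fun _ => F) s)) <
      Module.finrank F S := by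
  refine Submodule.finrank_lt_finrank_of_lt (lt_of_le_of_ne inf_le_left fun h => ?_)
  have hs' : (Pi.single s 1 : Q ⊕ Q → F) s = 0 := (h ▸ hs : _ ∈ S ⊓ _).2
  simp at hs'

lemma single_mem_map_of_apply_eq_smul {S : Submodule F (Q ⊕ Q → F)} {g : RowAut F Q}
    {v : Q ⊕ Q → F} (hv : v ∈ S) (hv0 : v ≠ 0) {s : Q ⊕ Q} {a : F} (hg : g v = a • Pi.single s 1) :
    Pi.single s 1 ∈ S.map (g : (Q ⊕ Q → F) →ₗ[F] (Q ⊕ Q → F)) := by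
  have ha : a ≠ 0 := by
    rintro rfl
    exact hv0 (g.map_eq_zero_iff.1 (hg.trans (zero_smul _ _)))
  exact ⟨a⁻¹ • v, S.smul_mem _ hv, by simp [hg, ha]⟩

variable [StarRing F] [Fintype Q]

lemma isotropic_inf_ker_proj_le_supported_erase {T : Finset Q} {S : Submodule F (Q ⊕ Q → F)}
    (hS : S ≤ supported F T) (hiso : ∀ u ∈ S, ∀ v ∈ S, symplecticForm u v = 0) {s : Q ⊕ Q}
    (hs : Pi.single s 1 ∈ S) :
    S ⊓ LinearMap.ker (LinearMap.proj s) ≤ supported F (T.erase (qubit s)) := fun u hu =>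
  mem_supported_erase (hS hu.1) hu.2 (by simpa using hiso u hu.1 _ hs)

/-- An induction on the number of target qubits. If a row of `S` is moved to a `Z` operator, then by
isotropy the rows of the image that vanish at this `Z` entry act on the other qubits only. -/
lemma exists_map_isotropic {U : Finset Q → Subgroup (RowAut F Q)} {κ : ℕ}
    (hU : ∀ T, U T ≤ localIsometryGroup T) (hmono : Monotone U)
    (htrans : ∀ T, κ < T.card → ∀ s, qubit s ∈ T → ∀ u ∈ supported F T,
      symplecticForm u u = 0 → ∃ g ∈ U T, ∃ a : F, g u = a • Pi.single s 1)
    {T₀ T : Finset Q} (hT₀ : T₀ ⊆ T) (hcard : T₀.card + κ ≤ T.card)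
    {S : Submodule F (Q ⊕ Q → F)} (hS : S ≤ supported F T)
    (hiso : ∀ u ∈ S, ∀ v ∈ S, symplecticForm u v = 0) (hdim : Module.finrank F S ≤ T₀.card) :
    ∃ g ∈ U T, ∀ u ∈ S, ∀ s ∉ Sum.inl '' (T₀ : Set Q), g u s = 0 := by
  induction T₀ using Finset.induction_on generalizing T S with
  | empty =>
    obtain rfl : S = ⊥ := Submodule.finrank_eq_zero.1 (by simpa using hdim)
    exact ⟨1, one_mem _, by simp⟩
  | insert q T₀ hq ih =>
    rcases eq_or_ne S ⊥ with rfl | hS0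
    · exact ⟨1, one_mem _, by simp⟩
    have hqT : q ∈ T := hT₀ (Finset.mem_insert_self _ _)
    rw [Finset.card_insert_of_notMem hq] at hcard hdim
    have hcard_erase := Finset.card_erase_add_one hqT
    obtain ⟨v, hv, hv0⟩ := (Submodule.ne_bot_iff S).1 hS0
    obtain ⟨g, hg, a, hga⟩ := htrans T (by omega) (Sum.inl q) hqT v (hS hv) (hiso v hv v hv)
    set e : Q ⊕ Q → F := Pi.single (Sum.inl q) 1
    set S₁ := S.map (g : (Q ⊕ Q → F) →ₗ[F] (Q ⊕ Q → F))
    have he : e ∈ S₁ := single_mem_map_of_apply_eq_smul hv hv0 hga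
    have hS₁ : S₁ ≤ supported F T :=
      Submodule.map_le_iff_le_comap.2 fun u hu => apply_mem_supported (hU T hg) (hS hu)
    have hiso₁ : ∀ u ∈ S₁, ∀ v ∈ S₁, symplecticForm u v = 0 := by
      rintro _ ⟨u, hu, rfl⟩ _ ⟨v, hv, rfl⟩
      exact ((hU T hg).1 u v).trans (hiso u hu v hv)
    have hdim₁ : Module.finrank F S₁ = Module.finrank F S := LinearEquiv.finrank_map_eq g S
    have hdim₂ := finrank_inf_ker_proj_lt he
    obtain ⟨h, hh, hhS⟩ := ih (T := T.erase q)
      (fun r hr => Finset.mem_erase.2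
        ⟨fun hrq => hq (hrq ▸ hr), hT₀ (Finset.mem_insert_of_mem hr)⟩)
      (by omega) (isotropic_inf_ker_proj_le_supported_erase hS₁ hiso₁ he)
      (fun u hu v hv => hiso₁ u hu.1 v hv.1) (by omega)
    have hhe : h e = e := (hU _ hh).2 e (single_mem_supported (by simp [qubit]) 1)
    refine ⟨h * g, mul_mem (hmono (Finset.erase_subset _ _) hh) hg, fun u hu s hs => ?_⟩
    have hgu : g u ∈ S₁ := ⟨u, hu, rfl⟩
    have hhu := hhS (g u - g u (Sum.inl q) • e) ⟨S₁.sub_mem hgu (S₁.smul_mem _ he), by simp [e]⟩ s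
      fun hs' => hs (Set.image_mono (by simp) hs')
    have hes : e s = 0 := Pi.single_eq_of_ne (fun hsq => hs ⟨q, by simp, hsq.symm⟩) 1
    rw [map_sub, map_smul, hhe, Pi.sub_apply, Pi.smul_apply, hes, smul_zero, sub_zero] at hhu
    exact hhu

end Witt

section Bases

variable {F Q : Type*} [Field F] [StarRing F] [Fintype Q]

lemma symplecticForm_eq_zero_of_mem_span {ι κ : Type*} {M : ι → Q ⊕ Q → F} {N : κ → Q ⊕ Q → F}
    (h : ∀ i j, symplecticForm (M i) (N j) = 0) {u v : Q ⊕ Q → F}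
    (hu : u ∈ Submodule.span F (Set.range M)) (hv : v ∈ Submodule.span F (Set.range N)) :
    symplecticForm u v = 0 := by
  have hMv : ∀ i, symplecticForm (M i) v = 0 := fun i =>
    Submodule.span_le.2 (Set.range_subset_iff.2 fun j => h i j :
      Set.range N ⊆ LinearMap.ker (symplecticForm (M i))) hv
  exact Submodule.span_le.2 (Set.range_subset_iff.2 hMv :
    Set.range M ⊆ LinearMap.ker (symplecticForm.flip v)) hu

lemma card_le_of_isotropic {ρ : Type*} [Fintype ρ] {M : ρ → Q ⊕ Q → F}
    (hM : LinearIndependent F M) (hiso : ∀ r r', symplecticForm (M r) (M r') = 0) :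
    Fintype.card ρ ≤ Fintype.card Q := by
  let N : Matrix ρ (Q ⊕ Q) F := Matrix.of fun r s => star (M r s.swap)
  have hMN : Matrix.of M * N.transpose = 0 := Matrix.ext hiso
  have hN : LinearIndependent F N.row := by
    refine hM.map_of_surjective_injectiveₛ (starRingEnd F)
      ((starAddEquiv (R := Q ⊕ Q → F)).toAddMonoidHom.comp
        (LinearMap.funLeft F F Sum.swap).toAddMonoidHom) star_involutive.surjective
      (fun u v huv => funext fun s => ?_) (fun a u => funext fun s => star_mul' a (u s.swap))
    have h : star (u s.swap.swap) = star (v s.swap.swap) := congrFun huv s.swap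
    simpa using h
  have h := Matrix.rank_add_rank_le_card_of_mul_eq_zero hMN
  rw [Matrix.rank_transpose, LinearIndependent.rank_matrix (M := Matrix.of M) hM,
    LinearIndependent.rank_matrix hN, Fintype.card_sum] at h
  omega

variable [DecidableEq Q]

lemma mem_supported_compl_map {ι : Type*} {φ : ι ↪ Q} {P : Finset ι} {u : Q ⊕ Q → F}
    (h : ∀ s, qubit s ∈ P → symplecticForm (Pi.single (s.map φ φ) 1) u = 0) :
    u ∈ supported F (P.map φ)ᶜ := by
  intro t ht
  obtain ⟨i, hi, hit⟩ := Finset.mem_map.1 (Finset.notMem_compl.1 ht)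
  rcases t with q | q <;> obtain rfl : φ i = q := hit
  · simpa using h (Sum.inr i) hi
  · simpa using h (Sum.inl i) hi

variable [CharP F 2]

lemma exists_mem_cliffordGroup_map_isotropic {T : Finset Q} {S : Submodule F (Q ⊕ Q → F)}
    (hS : S ≤ supported F T) (hiso : ∀ u ∈ S, ∀ v ∈ S, symplecticForm u v = 0)
    (hdim : Module.finrank F S ≤ T.card) :
    ∃ g ∈ cliffordGroup F T, ∀ u ∈ S, ∀ s ∉ Sum.inl '' (T : Set Q), g u s = 0 := by
  refine exists_map_isotropic (κ := 0) cliffordGroup_le_localIsometryGroup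
    (fun _ _ => cliffordGroup_mono) (fun T _ s hs u huT hu => ?_) le_rfl le_rfl hS hiso hdim
  rcases eq_or_ne u 0 with rfl | hu0
  · exact ⟨1, one_mem _, 0, by simp⟩
  · obtain ⟨g, hg, hgu⟩ := exists_mem_cliffordGroup_map_eq_single hs huT hu0 hu
    exact ⟨g, hg, 1, by rw [hgu, one_smul]⟩

lemma exists_map_hyperbolic_pair {T : Finset Q} {s : Q ⊕ Q} (hs : qubit s ∈ T) {u v : Q ⊕ Q → F}
    (hu : u ∈ supported F T) (hv : v ∈ supported F T) (huu : symplecticForm u u = 0)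
    (hvv : symplecticForm v v = 0) (huv : symplecticForm u v = 1) :
    ∃ g ∈ cliffordGroup F T, g u = Pi.single s 1 ∧ g v = Pi.single s.swap 1 := by
  have hv0 : v ≠ 0 := by
    rintro rfl
    simp at huv
  obtain ⟨g, hg, hgv⟩ := exists_mem_cliffordGroup_map_eq_single
    (by simpa using hs : qubit s.swap ∈ T) hv hv0 hvv
  have hgl := cliffordGroup_le_localIsometryGroup T hg
  have hgu : g u s = 1 := by simpa [hgl.1, huv] using (congrArg (symplecticForm (g u)) hgv).symm
  obtain ⟨h, hh, hhu, hhs⟩ := exists_map_eq_single_of_apply_eq_one (A := ⊤)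
    (fun _ _ => Subring.mem_top _) hs (fun _ => Subring.mem_top _) (apply_mem_supported hgl hu) hgu
    (by rw [hgl.1, huu])
  exact ⟨h * g, mul_mem (elementaryGroup_le_cliffordGroup T hh) hg, hhu,
    (congrArg h hgv).trans hhs⟩

lemma exists_map_hyperbolic {ι : Type*} [DecidableEq ι] (φ : ι ↪ Q) {w : ι ⊕ ι → Q ⊕ Q → F}
    (hw : ∀ s s', symplecticForm (w s) (w s') = if s' = s.swap then 1 else 0) (P : Finset ι) :
    ∃ g ∈ cliffordGroup F (Finset.univ : Finset Q),
      ∀ s, qubit s ∈ P → g (w s) = Pi.single (s.map φ φ) 1 := by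
  induction P using Finset.induction_on with
  | empty => exact ⟨1, one_mem _, by simp⟩
  | insert i P hi ih =>
    obtain ⟨g, hg, hgw⟩ := ih
    have hgl := (cliffordGroup_le_localIsometryGroup _ hg).1
    have hgT : ∀ t, qubit t = i → g (w t) ∈ supported F (P.map φ)ᶜ := fun t ht =>
      mem_supported_compl_map fun s hs => by
        rw [← hgw s hs, hgl, hw, if_neg]
        rintro rfl
        exact hi (ht ▸ qubit_swap s ▸ hs)
    obtain ⟨h, hh, hhz, hhx⟩ := exists_map_hyperbolic_pair (T := (P.map φ)ᶜ) (s := Sum.inl (φ i))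
      (by simpa [qubit] using hi) (hgT (Sum.inl i) rfl) (hgT (Sum.inr i) rfl) (by simp [hgl, hw])
      (by simp [hgl, hw]) (by simp [hgl, hw])
    refine ⟨h * g, mul_mem (cliffordGroup_mono (Finset.subset_univ _) hh) hg, fun s hs => ?_⟩
    by_cases hsP : qubit s ∈ P
    · rw [LinearEquiv.mul_apply, hgw s hsP]
      exact (cliffordGroup_le_localIsometryGroup _ hh).2 _
        (single_mem_supported (by simpa [qubit_map] using hsP) 1)
    · obtain rfl : qubit s = i := (Finset.mem_insert.1 hs).resolve_right hsP
      rcases s with j | j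
      exacts [hhz, hhx]

lemma exists_map_symplectic_basis {ι α : Type*} [DecidableEq ι] (e : ι ⊕ α ≃ Q)
    {w : ι ⊕ ι → Q ⊕ Q → F} {r : α → Q ⊕ Q → F}
    (hw : ∀ s s', symplecticForm (w s) (w s') = if s' = s.swap then 1 else 0)
    (hwr : ∀ s j, symplecticForm (w s) (r j) = 0) (hr : ∀ j j', symplecticForm (r j) (r j') = 0) :
    ∃ g ∈ cliffordGroup F (Finset.univ : Finset Q),
      (∀ s, g (w s) = Pi.single (s.map (e ∘ Sum.inl) (e ∘ Sum.inl)) 1) ∧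
      ∀ j, ∀ s ∉ Set.range (Sum.inl ∘ e ∘ Sum.inr), g (r j) s = 0 := by
  have : Finite (ι ⊕ α) := Finite.of_equiv Q e.symm
  have : Fintype ι := @Fintype.ofFinite ι (Finite.sum_left α)
  have : Fintype α := @Fintype.ofFinite α (Finite.sum_right ι)
  let φ : ι ↪ Q := Function.Embedding.inl.trans e.toEmbedding
  let ψ : α ↪ Q := Function.Embedding.inr.trans e.toEmbedding
  have hφψ : (Finset.univ.map φ)ᶜ = Finset.univ.map ψ := by
    ext q
    obtain ⟨x, rfl⟩ := e.surjective q
    cases x <;> simp [φ, ψ]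
  obtain ⟨g, hg, hgw⟩ := exists_map_hyperbolic φ hw Finset.univ
  have hgl := (cliffordGroup_le_localIsometryGroup _ hg).1
  have hgr : ∀ j, g (r j) ∈ supported F (Finset.univ.map ψ) := fun j =>
    hφψ ▸ mem_supported_compl_map fun s hs => by rw [← hgw s hs, hgl, hwr]
  obtain ⟨h, hh, hhr⟩ := exists_mem_cliffordGroup_map_isotropic
    (Submodule.span_le.2 (Set.range_subset_iff.2 hgr))
    (fun u hu v hv => symplecticForm_eq_zero_of_mem_span (fun j j' => by rw [hgl, hr]) hu hv)
    ((finrank_range_le_card fun j => g (r j)).trans_eq (by simp))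
  refine ⟨h * g, mul_mem (cliffordGroup_mono (Finset.subset_univ _) hh) hg, fun s => ?_,
    fun j s hs => hhr _ (Submodule.subset_span ⟨j, rfl⟩) s ?_⟩
  · rw [LinearEquiv.mul_apply, hgw s (Finset.mem_univ _)]
    exact (cliffordGroup_le_localIsometryGroup _ hh).2 _
      (single_mem_supported (by simp [qubit_map, ← hφψ]) 1)
  · rw [Finset.coe_map, Finset.coe_univ, Set.image_univ, ← Set.range_comp]
    exact hs

end Bases

section ElementaryWitt

variable {F Q : Type*} [Field F] [StarRing F] [CharP F 2] [DecidableEq Q] [Fintype Q]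
  {A : Subring F} {size : F → ℕ}

lemma exists_mem_elementaryGroup_map_isotropic (hA : ∀ x ∈ A, star x ∈ A)
    (hdiv : ∀ x ∈ A, ∀ b ∈ A, b ≠ 0 → ∃ q ∈ A, x + q * b = 0 ∨ size (x + q * b) < size b)
    (hden : ∀ u : Q ⊕ Q → F, ∃ d : F, d ≠ 0 ∧ ∀ t, d * u t ∈ A) {T₀ : Finset Q}
    (hcard : T₀.card < Fintype.card Q) {S : Submodule F (Q ⊕ Q → F)}
    (hiso : ∀ u ∈ S, ∀ v ∈ S, symplecticForm u v = 0) (hdim : Module.finrank F S ≤ T₀.card) :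
    ∃ g ∈ elementaryGroup A Finset.univ, ∀ u ∈ S, ∀ s ∉ Sum.inl '' (T₀ : Set Q), g u s = 0 :=
  exists_map_isotropic (κ := 1) (U := elementaryGroup A)
    (elementaryGroup_le_localIsometryGroup A) (fun _ _ => elementaryGroup_mono)
    (fun _ hT _ hs _ hu h => exists_mem_elementaryGroup_map_eq_smul_single hA hdiv hden hT hs hu h)
    T₀.subset_univ hcard (le_top.trans_eq supported_univ.symm) hiso hdim

end ElementaryWitt

/-! ### Conjugation by Hadamard gates and scalings -/

section Conjugation

variable {R Q : Type*} [CommRing R] [DecidableEq Q]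

/-- The exchange of the two columns of the qubit `q`. -/
def swapColumns (q : Q) : Equiv.Perm (Q ⊕ Q) := Equiv.swap (Sum.inl q) (Sum.inr q)

@[simp]
lemma swapColumns_swapColumns (q : Q) (s : Q ⊕ Q) : swapColumns q (swapColumns q s) = s :=
  Equiv.swap_apply_self _ _ _

@[simp]
lemma swapColumns_swap (q : Q) (s : Q ⊕ Q) : swapColumns q s.swap = (swapColumns q s).swap := by
  rcases s with i | i <;> by_cases h : i = q <;> simp [swapColumns, Equiv.swap_apply_def, h]

lemma swapColumns_eq_iff {q : Q} {s t : Q ⊕ Q} : swapColumns q s = t ↔ s = swapColumns q t :=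
  Equiv.swap_apply_eq_iff

lemma swapColumns_qubit (s : Q ⊕ Q) : swapColumns (qubit s) s = s.swap := by
  cases s <;> simp [swapColumns, qubit]

lemma swapColumns_of_ne {q : Q} {s : Q ⊕ Q} (h : qubit s ≠ q) : swapColumns q s = s := by
  refine Equiv.swap_apply_of_ne_of_ne ?_ ?_ <;> rintro rfl <;> exact h rfl

variable (R) in
/-- The column operation of the Hadamard gate on the qubit `q`. -/
def hadamard (q : Q) : RowAut R Q := LinearEquiv.funCongrLeft R R (swapColumns q)

lemma hadamard_apply (q : Q) (u : Q ⊕ Q → R) (s : Q ⊕ Q) :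
    hadamard R q u s = u (swapColumns q s) := rfl

lemma hadamard_hadamard (q : Q) (u : Q ⊕ Q → R) : hadamard R q (hadamard R q u) = u := by
  ext s
  simp [hadamard_apply]

lemma hadamard_single (q : Q) (s : Q ⊕ Q) (x : R) :
    hadamard R q (Pi.single s x) = Pi.single (swapColumns q s) x := by
  ext t
  simp only [hadamard_apply, Pi.single_apply, swapColumns_eq_iff]

section Transvection

variable [CharP R 2]

lemma transvection_zero (s : Q ⊕ Q) : transvection s (0 : R) = 1 := by
  ext1 u
  simp [transvection_apply]

lemma transvection_add (s : Q ⊕ Q) (p p' : R) :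
    transvection s (p + p') = transvection s p * transvection s p' := by
  ext1 u
  simp only [LinearEquiv.mul_apply, transvection_apply, Pi.add_apply, single_swap_apply, add_zero,
    add_mul, Pi.single_add]
  abel

lemma hadamard_mul_transvection_mul_hadamard (s : Q ⊕ Q) (p : R) :
    hadamard R (qubit s) * transvection s p * hadamard R (qubit s) = transvection s.swap p := by
  ext1 u
  simp [transvection_apply, hadamard_apply, hadamard_hadamard, hadamard_single, swapColumns_qubit]

end Transvection

variable [StarRing R]

section Eichler

variable [CharP R 2] {s s' : Q ⊕ Q} (h : qubit s ≠ qubit s')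

lemma eichler_zero : eichler s s' h (0 : R) = 1 := by
  ext1 u
  simp [eichler_apply]

lemma eichler_add (f f' : R) :
    eichler s s' h (f + f') = eichler s s' h f * eichler s s' h f' := by
  have h' : qubit s.swap ≠ qubit s'.swap := by simpa using h
  ext1 u
  simp only [LinearEquiv.mul_apply, eichler_apply, Pi.add_apply, single_swap_apply,
    single_apply_swap, single_of_qubit_ne h.symm, single_of_qubit_ne h', add_zero, add_mul,
    star_add, Pi.single_add]
  abel

lemma hadamard_mul_eichler_mul_hadamard_left (f : R) :
    hadamard R (qubit s) * eichler s s' h f * hadamard R (qubit s) =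
      eichler s.swap s' (by simpa) f := by
  have hs' : swapColumns (qubit s) s' = s' := swapColumns_of_ne h.symm
  ext1 u
  simp [eichler_apply, hadamard_apply, hadamard_hadamard, hadamard_single, swapColumns_qubit, hs']

lemma hadamard_mul_eichler_mul_hadamard_right (f : R) :
    hadamard R (qubit s') * eichler s s' h f * hadamard R (qubit s') =
      eichler s s'.swap (by simpa) f := by
  have hs : swapColumns (qubit s') s = s := swapColumns_of_ne h
  ext1 u
  simp [eichler_apply, hadamard_apply, hadamard_hadamard, hadamard_single, swapColumns_qubit, hs]

end Eichler

lemma scaling_swap (s : Q ⊕ Q) (f : Rˣ) : scaling s.swap f = scaling s (star f)⁻¹ := by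
  ext1 u
  ext t
  rw [scaling_apply, scaling_apply]
  rcases eq_or_ne t s with rfl | hs
  · simp [(swap_ne t).symm]
  · simp [hs]

lemma scaling_single (s t : Q ⊕ Q) (f : Rˣ) (x : R) : scaling s f (Pi.single t x) =
    Pi.single t ((if t = s then f else if t = s.swap then (star f)⁻¹ else 1 : Rˣ) * x) := by
  ext r
  rcases eq_or_ne r t with rfl | hr <;> simp [scaling_apply, *]

lemma hadamard_mul_scaling_mul_hadamard (s : Q ⊕ Q) (f : Rˣ) :
    hadamard R (qubit s) * scaling s f * hadamard R (qubit s) = scaling s.swap f := by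
  ext1 u
  ext t
  simp [scaling_apply, hadamard_apply, swapColumns_eq_iff, swapColumns_qubit]

variable [CharP R 2]

lemma scaling_mul_eichler_mul_scaling {s s' : Q ⊕ Q} (h : qubit s ≠ qubit s') (f : Rˣ) (g : R) :
    scaling s' f * eichler s s' h g * scaling s' f⁻¹ = eichler s s' h (f * g) := by
  have hne : s ≠ s' := by rintro rfl; exact h rfl
  have hne' : s ≠ s'.swap := by rintro rfl; exact h (qubit_swap s')
  have hne'' : s.swap ≠ s' := by rintro rfl; exact h (qubit_swap s).symm
  ext1 u
  rw [LinearEquiv.mul_apply, LinearEquiv.mul_apply, eichler_apply, map_add, map_add, scaling_single,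
    scaling_single, ← LinearEquiv.mul_apply, ← map_mul, mul_inv_cancel, map_one, eichler_apply]
  simp [scaling_apply, -map_inv, hne, hne', hne'', Sum.swap_rightInverse.injective.ne hne,
    swap_ne, mul_assoc, mul_left_comm]

lemma scaling_mul_transvection_mul_scaling (s : Q ⊕ Q) (f : Rˣ) (p : R) :
    scaling s f⁻¹ * transvection s p * scaling s f = transvection s (star ↑f * p * f) := by
  ext1 u
  rw [LinearEquiv.mul_apply, LinearEquiv.mul_apply, transvection_apply, map_add, scaling_single,
    ← LinearEquiv.mul_apply, ← map_mul, inv_mul_cancel, map_one, transvection_apply]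
  simp [scaling_apply, swap_ne, mul_assoc]

end Conjugation

/-! ### Laurent polynomials and circuits -/

section Laurent

lemma toK_T (l : ℤ) : Laurent.toK (LaurentPolynomial.T l) = D ^ l := by
  simp [Laurent.toK]

lemma toK_C (r : ZMod 2) : Laurent.toK (LaurentPolynomial.C r) = algebraMap (ZMod 2) K r := by
  simp [Laurent.toK]

lemma toK_toLaurent (p : (ZMod 2)[X]) :
    Laurent.toK (Polynomial.toLaurent p) = algebraMap (ZMod 2)[X] K p := by
  have h : Laurent.toK.comp Polynomial.toLaurent = algebraMap (ZMod 2)[X] K := by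
    refine Polynomial.ringHom_ext (fun r => ?_) ?_
    · simp [toK_C]
    · simp [toK_T, D, RatFunc.algebraMap_X]
  exact congrArg (fun φ => φ p) h

lemma exists_toK_eq (f : Laurent) :
    ∃ (l : ℤ) (p : (ZMod 2)[X]), Laurent.toK f = D ^ l * algebraMap (ZMod 2)[X] K p := by
  obtain ⟨n, p, hp⟩ := LaurentPolynomial.exists_T_pow f
  refine ⟨-n, p, ?_⟩
  rw [← toK_toLaurent, hp, map_mul, toK_T, mul_left_comm, ← zpow_add₀ D_ne_zero]
  simp

lemma toK_injective : Function.Injective Laurent.toK := by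
  refine (injective_iff_map_eq_zero _).2 fun f hf => ?_
  obtain ⟨n, p, hp⟩ := LaurentPolynomial.exists_T_pow f
  have hp0 : algebraMap (ZMod 2)[X] K p = 0 := by
    rw [← toK_toLaurent, hp, map_mul, hf, zero_mul]
  rw [(map_eq_zero_iff _ (RatFunc.algebraMap_injective (ZMod 2))).1 hp0, map_zero] at hp
  exact (LaurentPolynomial.isUnit_T n).mul_left_eq_zero.1 hp.symm

lemma exists_toK_div (a : K) : ∃ f g : Laurent, g ≠ 0 ∧ a = Laurent.toK f / Laurent.toK g := by
  refine ⟨Polynomial.toLaurent a.num, Polynomial.toLaurent a.denom, ?_, ?_⟩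
  · simpa using a.denom_ne_zero
  · rw [toK_toLaurent, toK_toLaurent, RatFunc.num_div_denom]

lemma timeReversal_algebraMap (p : (ZMod 2)[X]) :
    timeReversal (algebraMap (ZMod 2)[X] K p) = Polynomial.aeval (D⁻¹ : K) p := by
  simp [timeReversal, RatFunc.liftRingHom_apply]

lemma timeReversal_D : timeReversal D = D⁻¹ := by
  rw [D, ← RatFunc.algebraMap_X, timeReversal_algebraMap]
  simp [D]

lemma timeReversal_C (r : ZMod 2) : timeReversal (RatFunc.C r) = RatFunc.C r := by
  rw [← RatFunc.algebraMap_C, timeReversal_algebraMap]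
  simp

lemma timeReversal_involutive : Function.Involutive timeReversal := by
  have h : timeReversal.comp timeReversal = RingHom.id K := by
    refine IsLocalization.ringHom_ext (nonZeroDivisors (ZMod 2)[X])
      (Polynomial.ringHom_ext (fun r => ?_) ?_)
    · simp [timeReversal_C]
    · have hX : algebraMap (ZMod 2)[X] K X = D := RatFunc.algebraMap_X
      simp [hX, timeReversal_D]
  exact fun a => congrArg (fun φ => φ a) h

instance : StarRing K where
  star := timeReversal
  star_involutive := timeReversal_involutive
  star_mul a b := (map_mul timeReversal a b).trans (mul_comm _ _)
  star_add := map_add timeReversal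

lemma star_eq_timeReversal (a : K) : star a = timeReversal a := rfl

instance : CharP K 2 := charP_of_injective_algebraMap (algebraMap (ZMod 2) K).injective 2

lemma star_toK (f : Laurent) :
    star (Laurent.toK f) = Laurent.toK (LaurentPolynomial.invert f) := by
  rw [star_eq_timeReversal]
  induction f using LaurentPolynomial.induction_on' with
  | add p q hp hq => simp only [map_add, hp, hq]
  | C_mul_T n a => simp [toK_C, toK_T, timeReversal_C, timeReversal_D]

/-- The terms of positive degree of `f` have the terms of negative degree as time reversal. -/
lemma exists_eq_C_add_trace {f : Laurent} (hf : LaurentPolynomial.invert f = f) :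
    ∃ (c : ZMod 2) (g : Laurent),
      f = LaurentPolynomial.C c + (g + LaurentPolynomial.invert g) := by
  refine ⟨f.coeff 0, AddMonoidAlgebra.ofCoeff (f.coeff.filter fun l => 0 < l), ?_⟩
  ext l
  have h : f.coeff (-l) = f.coeff l := by
    conv_rhs => rw [← hf]
    simp
  rcases lt_trichotomy l 0 with hl | rfl | hl
  · simp [hl, hl.ne, not_lt.2 hl.le, h]
  · simp
  · simp [hl, hl.ne', not_lt.2 hl.le]

/-- The Laurent polynomials, as a subring of the rational functions. -/
def laurentSubring : Subring K := Laurent.toK.range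

lemma toK_mem (f : Laurent) : Laurent.toK f ∈ laurentSubring := ⟨f, rfl⟩

lemma star_mem_laurentSubring {a : K} (ha : a ∈ laurentSubring) : star a ∈ laurentSubring := by
  obtain ⟨f, rfl⟩ := ha
  exact star_toK f ▸ toK_mem _

/-- The Euclidean size of a Laurent polynomial: the least degree of a polynomial associated
with it. -/
def size (a : K) : ℕ :=
  sInf {d | ∃ (l : ℤ) (p : (ZMod 2)[X]), a = D ^ l * algebraMap (ZMod 2)[X] K p ∧ p.natDegree = d}

lemma size_le (l : ℤ) (p : (ZMod 2)[X]) : size (D ^ l * algebraMap (ZMod 2)[X] K p) ≤ p.natDegree :=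
  Nat.sInf_le ⟨l, p, rfl, rfl⟩

lemma exists_size_eq (f : Laurent) : ∃ (l : ℤ) (p : (ZMod 2)[X]),
    Laurent.toK f = D ^ l * algebraMap (ZMod 2)[X] K p ∧ p.natDegree = size (Laurent.toK f) := by
  obtain ⟨l, p, hp⟩ := exists_toK_eq f
  exact Nat.sInf_mem (s := {d | ∃ (l : ℤ) (p : (ZMod 2)[X]),
    Laurent.toK f = D ^ l * algebraMap (ZMod 2)[X] K p ∧ p.natDegree = d}) ⟨_, l, p, hp, rfl⟩

lemma exists_add_mul_size_lt {a b : K} (ha : a ∈ laurentSubring) (hb : b ∈ laurentSubring)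
    (hb0 : b ≠ 0) : ∃ q ∈ laurentSubring, a + q * b = 0 ∨ size (a + q * b) < size b := by
  obtain ⟨f, rfl⟩ := ha
  obtain ⟨g, rfl⟩ := hb
  obtain ⟨k, p, hp⟩ := exists_toK_eq f
  obtain ⟨l, r, hr, hd⟩ := exists_size_eq g
  have hr0 : r ≠ 0 := by
    rintro rfl
    simp [hr] at hb0
  refine ⟨Laurent.toK (-(LaurentPolynomial.T (k - l) * Polynomial.toLaurent (p / r))), toK_mem _,
    ?_⟩
  have hrem : Laurent.toK f +
      Laurent.toK (-(LaurentPolynomial.T (k - l) * Polynomial.toLaurent (p / r))) * Laurent.toK g =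
        D ^ k * algebraMap (ZMod 2)[X] K (p % r) := by
    have hD : D ^ (k - l) * D ^ l = D ^ k := by rw [← zpow_add₀ D_ne_zero, sub_add_cancel]
    rw [hp, hr, EuclideanDomain.mod_eq_sub_mul_div, map_neg, map_mul, toK_T, toK_toLaurent, map_sub,
      map_mul, ← hD]
    ring
  rw [hrem]
  by_cases h0 : p % r = 0
  · exact Or.inl (by simp [h0])
  · exact Or.inr ((size_le _ _).trans_lt
      (hd ▸ Polynomial.natDegree_lt_natDegree h0 (EuclideanDomain.mod_lt p hr0)))

lemma exists_common_denominator {ι : Type*} [Finite ι] (u : ι → K) :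
    ∃ d : K, d ≠ 0 ∧ ∀ i, d * u i ∈ laurentSubring := by
  obtain ⟨b, hb⟩ := IsLocalization.exist_integer_multiples_of_finite
    (nonZeroDivisors (ZMod 2)[X]) u
  refine ⟨algebraMap (ZMod 2)[X] K b, by simp, fun i => ?_⟩
  obtain ⟨p, hp⟩ := hb i
  rw [Algebra.smul_def] at hp
  exact hp ▸ toK_toLaurent p ▸ toK_mem _

end Laurent

section Circuits

lemma eq_zero_or_one : ∀ r : ZMod 2, r = 0 ∨ r = 1 := by decide

variable {Q : Type} [DecidableEq Q] {γ : Type*}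

/-- The column operations that are realized by circuits of the gates `ι x`. -/
def circuitMonoid (ι : γ → Gate Q) : Submonoid (RowAut K Q) where
  carrier := {g | ∃ C : List γ, ∀ u, runRow (C.map ι) u = g u}
  one_mem' := ⟨[], fun _ => rfl⟩
  mul_mem' := by
    rintro g h ⟨C, hC⟩ ⟨C', hC'⟩
    refine ⟨C' ++ C, fun u => ?_⟩
    rw [List.map_append, runRow, List.foldl_append, LinearEquiv.mul_apply, ← hC', ← hC]
    rfl

lemma mem_circuitMonoid {ι : γ → Gate Q} (x : γ) {g : RowAut K Q} (h : ∀ u, (ι x).apply u = g u) :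
    g ∈ circuitMonoid ι := ⟨[x], h⟩

lemma circuitMonoid_finite_le : circuitMonoid Gate.finite ≤ circuitMonoid (Q := Q) id := by
  rintro g ⟨C, hC⟩
  exact ⟨C.map Gate.finite, by simpa using hC⟩

lemma hadamard_mem_circuitMonoid (q : Q) : hadamard K q ∈ circuitMonoid Gate.finite :=
  mem_circuitMonoid (.hadamard q) fun _ => rfl

lemma eichler_inr_mem_circuitMonoid {i j : Q}
    (h : qubit (Sum.inr i : Q ⊕ Q) ≠ qubit (Sum.inr j)) (f : Laurent) :
    eichler (Sum.inr i) (Sum.inr j) h (Laurent.toK f) ∈ circuitMonoid Gate.finite := by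
  induction f using LaurentPolynomial.induction_on' with
  | add f f' hf hf' => exact (map_add Laurent.toK f f' ▸ eichler_add h _ _).symm ▸ mul_mem hf hf'
  | C_mul_T l r =>
    obtain rfl | rfl : r = 0 ∨ r = 1 := eq_zero_or_one r
    · rw [map_zero, zero_mul, map_zero, eichler_zero]
      exact one_mem _
    · refine mem_circuitMonoid (.cnot i j h l) fun u => ?_
      rw [map_one, one_mul, eichler_apply, star_toK, LaurentPolynomial.invert_T, toK_T, toK_T]
      rfl

lemma eichler_mem_circuitMonoid {s s' : Q ⊕ Q} (h : qubit s ≠ qubit s') {f : K}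
    (hf : f ∈ laurentSubring) : eichler s s' h f ∈ circuitMonoid Gate.finite := by
  obtain ⟨f, rfl⟩ := hf
  have h_left (i : Q) (s' : Q ⊕ Q) (h : qubit (Sum.inr i : Q ⊕ Q) ≠ qubit s')
      (hmem : eichler (Sum.inr i) s' h (Laurent.toK f) ∈ circuitMonoid Gate.finite) :
      eichler (Sum.inl i) s' h (Laurent.toK f) ∈ circuitMonoid Gate.finite :=
    hadamard_mul_eichler_mul_hadamard_left (s := Sum.inr i) h (Laurent.toK f) ▸
      mul_mem (mul_mem (hadamard_mem_circuitMonoid i) hmem) (hadamard_mem_circuitMonoid i)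
  have h_right (i j : Q) (h : qubit (Sum.inr i : Q ⊕ Q) ≠ qubit (Sum.inl j)) :
      eichler (Sum.inr i) (Sum.inl j) h (Laurent.toK f) ∈ circuitMonoid Gate.finite :=
    hadamard_mul_eichler_mul_hadamard_right (s' := Sum.inr j) h (Laurent.toK f) ▸
      mul_mem (mul_mem (hadamard_mem_circuitMonoid j) (eichler_inr_mem_circuitMonoid h f))
        (hadamard_mem_circuitMonoid j)
  rcases s with i | i <;> rcases s' with j | j
  exacts [h_left i _ h (h_right i j h), h_left i _ h (eichler_inr_mem_circuitMonoid h f),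
    h_right i j h, eichler_inr_mem_circuitMonoid h f]

lemma transvection_trace_mem_circuitMonoid (i : Q) (f : Laurent) :
    transvection (Sum.inr i) (Laurent.toK (f + LaurentPolynomial.invert f)) ∈
      circuitMonoid Gate.finite := by
  induction f using LaurentPolynomial.induction_on' with
  | add f f' hf hf' =>
    rw [map_add LaurentPolynomial.invert, add_add_add_comm, map_add, transvection_add]
    exact mul_mem hf hf'
  | C_mul_T l r =>
    obtain rfl | rfl : r = 0 ∨ r = 1 := eq_zero_or_one r
    · rw [map_zero, zero_mul, map_zero, add_zero, map_zero, transvection_zero]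
      exact one_mem _
    · have htrace : Laurent.toK (LaurentPolynomial.C 1 * LaurentPolynomial.T l +
          LaurentPolynomial.invert (LaurentPolynomial.C 1 * LaurentPolynomial.T l)) =
          D ^ l + D ^ (-l) := by
        rw [map_one, one_mul, LaurentPolynomial.invert_T, map_add, toK_T, toK_T]
      rw [htrace]
      rcases eq_or_ne l 0 with rfl | hl
      · rw [neg_zero, CharTwo.add_self_eq_zero, transvection_zero]
        exact one_mem _
      · exact mem_circuitMonoid (.cphaseSelf i l hl) fun _ => rfl

lemma transvection_inr_mem_circuitMonoid (i : Q) {p : K} (hp : p ∈ laurentSubring)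
    (hstar : star p = p) : transvection (Sum.inr i) p ∈ circuitMonoid Gate.finite := by
  obtain ⟨f, rfl⟩ := hp
  rw [star_toK, toK_injective.eq_iff] at hstar
  obtain ⟨r, g, rfl⟩ := exists_eq_C_add_trace hstar
  rw [map_add, transvection_add]
  refine mul_mem ?_ (transvection_trace_mem_circuitMonoid i g)
  obtain rfl | rfl : r = 0 ∨ r = 1 := eq_zero_or_one r
  · rw [map_zero, map_zero, transvection_zero]
    exact one_mem _
  · refine mem_circuitMonoid (.phase i) fun u => ?_
    rw [map_one, map_one, transvection_apply, one_mul]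
    rfl

lemma transvection_mem_circuitMonoid (s : Q ⊕ Q) {p : K} (hp : p ∈ laurentSubring)
    (hstar : star p = p) : transvection s p ∈ circuitMonoid Gate.finite := by
  have h_inr (i : Q) := transvection_inr_mem_circuitMonoid i hp hstar
  rcases s with i | i
  · exact hadamard_mul_transvection_mul_hadamard (Sum.inr i) p ▸
      mul_mem (mul_mem (hadamard_mem_circuitMonoid i) (h_inr i)) (hadamard_mem_circuitMonoid i)
  · exact h_inr i

lemma elementaryGroup_le_circuitMonoid (T : Finset Q) :
    (elementaryGroup laurentSubring T).toSubmonoid ≤ circuitMonoid Gate.finite :=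
  elementaryGroup_toSubmonoid_le (fun _ _ h _ hf _ _ => eichler_mem_circuitMonoid h hf)
    (fun s _ hp hstar _ => transvection_mem_circuitMonoid s hp hstar)

lemma scaling_inr_inv_mem_circuitMonoid (i : Q) {f : Laurent} (hf : Laurent.toK f ≠ 0) :
    scaling (Sum.inr i) (Units.mk0 _ hf)⁻¹ ∈ circuitMonoid (Q := Q) id := by
  refine mem_circuitMonoid (.infinite i f (by rintro rfl; simp at hf)) fun u => ?_
  ext t
  rw [scaling_apply]
  rcases eq_or_ne t (Sum.inl i) with rfl | hl
  · simp [Gate.apply, star_eq_timeReversal]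
  rcases eq_or_ne t (Sum.inr i) with rfl | hr
  · simp [Gate.apply]
  · simp [Gate.apply, hl, hr]

lemma scaling_swap_mem_circuitMonoid {s : Q ⊕ Q} {f : Kˣ}
    (h : scaling s f ∈ circuitMonoid (Q := Q) id) :
    scaling s.swap f ∈ circuitMonoid (Q := Q) id :=
  have h_hadamard := circuitMonoid_finite_le (hadamard_mem_circuitMonoid (qubit s))
  hadamard_mul_scaling_mul_hadamard s f ▸ mul_mem (mul_mem h_hadamard h) h_hadamard

lemma scaling_inr_toK_mem_circuitMonoid (i : Q) {f : Laurent} (hf : Laurent.toK f ≠ 0) :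
    scaling (Sum.inr i) (Units.mk0 _ hf) ∈ circuitMonoid (Q := Q) id := by
  have hf' : Laurent.toK (LaurentPolynomial.invert f) ≠ 0 := star_toK f ▸ star_ne_zero.2 hf
  have h_star : star (Units.mk0 _ hf) = Units.mk0 _ hf' := Units.ext (star_toK f)
  have h_swap : scaling (Sum.inr i) (Units.mk0 _ hf) =
      scaling (Sum.inl i) (Units.mk0 _ hf')⁻¹ := by
    rw [← h_star]
    exact scaling_swap (Sum.inl i) _
  rw [h_swap]
  exact scaling_swap_mem_circuitMonoid (s := Sum.inr i) (scaling_inr_inv_mem_circuitMonoid i hf')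

lemma scaling_mem_circuitMonoid (s : Q ⊕ Q) (f : Kˣ) :
    scaling s f ∈ circuitMonoid (Q := Q) id := by
  have h_inr (i : Q) : scaling (Sum.inr i) f ∈ circuitMonoid (Q := Q) id := by
    obtain ⟨a, b, hb, hab⟩ := exists_toK_div (f : K)
    have hb' : Laurent.toK b ≠ 0 := (map_ne_zero_iff _ toK_injective).2 hb
    have ha' : Laurent.toK a ≠ 0 := by
      intro ha
      rw [ha, zero_div] at hab
      exact f.ne_zero hab
    have hf : f = Units.mk0 _ ha' * (Units.mk0 _ hb')⁻¹ := by
      ext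
      rw [hab, Units.val_mul, Units.val_inv_eq_inv_val, Units.val_mk0, Units.val_mk0,
        div_eq_mul_inv]
    rw [hf, map_mul]
    exact mul_mem (scaling_inr_toK_mem_circuitMonoid i ha')
      (scaling_inr_inv_mem_circuitMonoid i hb')
  rcases s with i | i
  · exact scaling_swap_mem_circuitMonoid (s := Sum.inr i) (h_inr i)
  · exact h_inr i

lemma eichler_mem_circuitMonoid_id {s s' : Q ⊕ Q} (h : qubit s ≠ qubit s') (f : K) :
    eichler s s' h f ∈ circuitMonoid id := by
  rcases eq_or_ne f 0 with rfl | hf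
  · rw [eichler_zero]
    exact one_mem _
  have h_conj := scaling_mul_eichler_mul_scaling h (Units.mk0 f hf) 1
  rw [mul_one, Units.val_mk0] at h_conj
  rw [← h_conj]
  exact mul_mem (mul_mem (scaling_mem_circuitMonoid _ _)
    (circuitMonoid_finite_le (eichler_mem_circuitMonoid h (one_mem _))))
    (scaling_mem_circuitMonoid _ _)

/-- If `p = f / g`, then the conjugate of the transvection by a scaling with `g` has the Laurent
polynomial coefficient `g(D⁻¹) p g(D) = f(D) g(D⁻¹)`. -/
lemma transvection_mem_circuitMonoid_id (s : Q ⊕ Q) {p : K} (hp : star p = p) :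
    transvection s p ∈ circuitMonoid id := by
  obtain ⟨f, g, hg, hfg⟩ := exists_toK_div p
  have hg' : Laurent.toK g ≠ 0 := (map_ne_zero_iff _ toK_injective).2 hg
  set b : Kˣ := Units.mk0 _ hg' with hb
  have hmem : star (b : K) * p * b ∈ laurentSubring := by
    rw [hfg, mul_assoc, hb, Units.val_mk0, div_mul_cancel₀ _ hg']
    exact mul_mem (star_mem_laurentSubring (toK_mem g)) (toK_mem f)
  have hstar : star (star (b : K) * p * b) = star (b : K) * p * b := by
    rw [star_mul, star_mul, star_star, hp, mul_assoc]
  have h_conj := scaling_mul_transvection_mul_scaling s b⁻¹ (star (b : K) * p * b)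
  have h_coeff : star ((b⁻¹ : Kˣ) : K) * (star (b : K) * p * b) * (b⁻¹ : Kˣ) = p := by
    rw [mul_assoc, mul_assoc, Units.mul_inv, mul_one, ← mul_assoc, ← star_mul, Units.mul_inv,
      star_one, one_mul]
  rw [h_coeff] at h_conj
  rw [← h_conj]
  exact mul_mem (mul_mem (scaling_mem_circuitMonoid _ _)
    (circuitMonoid_finite_le (transvection_mem_circuitMonoid s hmem hstar)))
    (scaling_mem_circuitMonoid _ _)

lemma cliffordGroup_le_circuitMonoid (T : Finset Q) :
    (cliffordGroup K T).toSubmonoid ≤ circuitMonoid id := by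
  refine (Subgroup.gc_toSubmonoid_mulSupport _ _).2 (sup_le
    ((Subgroup.gc_toSubmonoid_mulSupport _ _).1 (elementaryGroup_toSubmonoid_le
      (fun _ _ h f _ _ _ => eichler_mem_circuitMonoid_id h f)
      (fun s _ _ hstar _ => transvection_mem_circuitMonoid_id s hstar))) ?_)
  rw [Subgroup.closure_le]
  rintro _ ⟨s, f, -, rfl⟩
  refine ⟨scaling_mem_circuitMonoid s f, ?_⟩
  rw [Submonoid.coe_inv, Set.mem_inv, SetLike.mem_coe, ← map_inv]
  exact scaling_mem_circuitMonoid s f⁻¹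

lemma isFiniteDepth_of_runRow_eq {C : List (Gate Q)} {T : Finset Q} {g : RowAut K Q}
    (hg : g ∈ elementaryGroup laurentSubring T) (hC : ∀ u, runRow C u = g u) :
    IsFiniteDepth C := fun u hu s => by
  obtain ⟨f, hf⟩ := elementaryGroup_apply_mem (fun _ => star_mem_laurentSubring) hg
    (fun t => (hu t).imp fun _ => Eq.symm) s
  exact ⟨f, by rw [hC, hf]⟩

end Circuits

section Online

variable {Q : Type}

lemma eventually_actsWithin (g : Gate Q) : ∀ᶠ N : ℕ in Filter.atTop, g.ActsWithin N := by
  have h_lt (l : ℤ) : ∀ᶠ N : ℕ in Filter.atTop, l < N :=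
    tendsto_natCast_atTop_atTop.eventually_gt_atTop l
  match g with
  | .finite (.cnot _ _ _ l) => exact h_lt |l|
  | .finite (.hadamard _) => exact Filter.eventually_gt_atTop 0
  | .finite (.phase _) => exact Filter.eventually_gt_atTop 0
  | .finite (.cphase _ _ _ l) => exact h_lt |l|
  | .finite (.cphaseSelf _ l _) => exact h_lt |l|
  | .infinite _ f _ =>
    have h_support : ∀ᶠ N : ℕ in Filter.atTop,
        ∀ p ∈ f.coeff.support, ∀ q ∈ f.coeff.support, p - q < N := by
      simp only [Filter.eventually_all_finset]
      exact fun p _ q _ => h_lt (p - q)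
    filter_upwards [h_support] with N hN p q hp hq
    exact hN p (Finsupp.mem_support_iff.2 hp) q (Finsupp.mem_support_iff.2 hq)

lemma isOnline (C : List (Gate Q)) : IsOnline C :=
  ((Filter.eventually_all_finite C.finite_toSet).2 fun g _ => eventually_actsWithin g).exists

end Online

/-! ### The decoder and the encoder -/

section Join

variable {P Q : Type}

/-- The row with the given parts on two sets of qubits. -/
def join : (Row P × Row Q) ≃ₗ[K] Row (P ⊕ Q) :=
  (LinearEquiv.sumArrowLequivProdArrow _ _ K K).symm ≪≫ₗ
    LinearEquiv.funCongrLeft K K (Equiv.sumSumSumComm P Q P Q)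

@[simp]
lemma join_apply_inl (u : Row P × Row Q) (s : P ⊕ P) :
    join u (s.map Sum.inl Sum.inl) = u.1 s := by
  cases s <;> rfl

@[simp]
lemma join_apply_inr (u : Row P × Row Q) (s : Q ⊕ Q) :
    join u (s.map Sum.inr Sum.inr) = u.2 s := by
  cases s <;> rfl

lemma row_ext {u v : Row (P ⊕ Q)}
    (hl : ∀ s : P ⊕ P, u (s.map Sum.inl Sum.inl) = v (s.map Sum.inl Sum.inl))
    (hr : ∀ s : Q ⊕ Q, u (s.map Sum.inr Sum.inr) = v (s.map Sum.inr Sum.inr)) : u = v := by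
  ext s
  rcases s with (p | q) | (p | q)
  exacts [hl (Sum.inl p), hr (Sum.inl q), hl (Sum.inr p), hr (Sum.inr q)]

lemma symplecticForm_join [Fintype P] [Fintype Q] (u v : Row P × Row Q) :
    symplecticForm (join u) (join v) = symplecticForm u.1 v.1 + symplecticForm u.2 v.2 := by
  simp only [symplecticForm_apply, Fintype.sum_sum_type]
  exact add_add_add_comm _ _ _ _

lemma join_add_right (u : Row P) (v v' : Row Q) :
    join (u, v + v') = join (u, v) + join (0, v') := by
  rw [← map_add, Prod.mk_add_mk, add_zero]

lemma map_inr_ne_map_inl (s : Q ⊕ Q) (t : P ⊕ P) :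
    s.map (Sum.inr : Q → P ⊕ Q) Sum.inr ≠ t.map Sum.inl Sum.inl := by
  cases s <;> cases t <;> simp

variable [DecidableEq P] [DecidableEq Q]

lemma join_single_left (s : P ⊕ P) (x : K) :
    join (Pi.single s x, (0 : Row Q)) = Pi.single (s.map Sum.inl Sum.inl) x := by
  apply row_ext <;> intro t
  · simp only [join_apply_inl, Pi.single_apply,
      (Sum.map_injective.2 ⟨Sum.inl_injective, Sum.inl_injective⟩).eq_iff]
  · rw [join_apply_inr, Pi.single_eq_of_ne (map_inr_ne_map_inl t s)]
    rfl

lemma join_single_right (s : Q ⊕ Q) (x : K) :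
    join ((0 : Row P), Pi.single s x) = Pi.single (s.map Sum.inr Sum.inr) x := by
  apply row_ext <;> intro t
  · rw [join_apply_inl, Pi.single_eq_of_ne (map_inr_ne_map_inl s t).symm]
    rfl
  · simp only [join_apply_inr, Pi.single_apply,
      (Sum.map_injective.2 ⟨Sum.inr_injective, Sum.inr_injective⟩).eq_iff]

lemma join_comp_swap (u : Row P) (v : Row Q) (s t : Q ⊕ Q) :
    join (u, v ∘ Equiv.swap s t) =
      join (u, v) ∘ Equiv.swap (s.map Sum.inr Sum.inr) (t.map Sum.inr Sum.inr) := by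
  apply row_ext <;> intro r
  · rw [Function.comp_apply, Equiv.swap_apply_of_ne_of_ne (map_inr_ne_map_inl s r).symm
      (map_inr_ne_map_inl t r).symm, join_apply_inl, join_apply_inl]
  · rw [Function.comp_apply, join_apply_inr, Function.Injective.swap_apply
      (Sum.map_injective.2 ⟨Sum.inr_injective, Sum.inr_injective⟩), join_apply_inr]
    rfl

lemma join_update (u : Row P) (v : Row Q) (s : Q ⊕ Q) (x : K) :
    join (u, Function.update v s x) =
      Function.update (join (u, v)) (s.map Sum.inr Sum.inr) x := by
  apply row_ext <;> intro t
  · rw [Function.update_of_ne (map_inr_ne_map_inl s t).symm, join_apply_inl, join_apply_inl]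
  · simp only [join_apply_inr, Function.update_apply,
      (Sum.map_injective.2 ⟨Sum.inr_injective, Sum.inr_injective⟩).eq_iff]

lemma apply_map_inr_join (g : Gate Q) (u : Row P) (v : Row Q) :
    (g.map Function.Embedding.inr).apply (join (u, v)) = join (u, g.apply v) := by
  match g with
  | .finite (.hadamard i) => exact (join_comp_swap u v (Sum.inl i) (Sum.inr i)).symm
  | .infinite .. =>
    simp only [Gate.apply, join_update]
    rfl
  | .finite (.cnot ..) | .finite (.phase _) | .finite (.cphase ..) | .finite (.cphaseSelf ..) =>
    simp only [Gate.apply, FiniteGate.apply, join_add_right, join_single_right]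
    rfl

lemma runRow_onSender {c n : ℕ} (E : List (Gate (Fin n))) (u : Row (Fin c)) (v : Row (Fin n)) :
    runRow (onSender E) (join (u, v)) = join (u, runRow E v) := by
  induction E generalizing v with
  | nil => rfl
  | cons g E ih =>
    change runRow (onSender E) ((g.map Function.Embedding.inr).apply (join (u, v))) = _
    rw [apply_map_inr_join, ih]
    rfl

end Join

section Streams

variable {n c a m : ℕ}

/-- The column of the Pauli operator `Z` (for `0`) or `X` (for `1`) on a qubit. -/
def slot {Q : Type} : Fin 2 × Q ≃ Q ⊕ Q :=
  (finTwoEquiv.prodCongr (Equiv.refl Q)).trans (Equiv.boolProdEquivSum Q)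

@[simp]
lemma slot_zero {Q : Type} (q : Q) : slot (0, q) = Sum.inl q := rfl

@[simp]
lemma slot_one {Q : Type} (q : Q) : slot (1, q) = Sum.inr q := rfl

lemma slot_map {Q Q' : Type} (φ : Q → Q') (b : Fin 2) (q : Q) :
    (slot (b, q)).map φ φ = slot (b, φ q) := by
  fin_cases b <;> rfl

lemma qubit_slot {Q : Type} (p : Fin 2 × Q) : qubit (slot p) = p.2 := by
  obtain ⟨b, q⟩ := p
  fin_cases b <;> rfl

lemma slot_eq_swap_iff {Q : Type} {p p' : Fin 2 × Q} :
    slot p' = (slot p).swap ↔ p'.2 = p.2 ∧ p'.1 ≠ p.1 := by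
  obtain ⟨b, q⟩ := p
  obtain ⟨b', q'⟩ := p'
  fin_cases b <;> fin_cases b' <;> simp

lemma standardForm_inl_inl (p p' : Fin 2 × Fin c) :
    standardForm c a (Sum.inl p) (Sum.inl p') = if slot p' = (slot p).swap then 1 else 0 := by
  rw [standardForm, Matrix.fromBlocks_apply₁₁, Matrix.blockDiagonal_apply]
  obtain ⟨b, i⟩ := p
  obtain ⟨b', i'⟩ := p'
  simp only [slot_eq_swap_iff]
  fin_cases b <;> fin_cases b' <;> simp [eq_comm]

/-- The part of the unencoded stabilizer on the receiver's qubits. -/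
def receiverStabilizer : GenIdx c a → Row (Fin c)
  | Sum.inl p => Pi.single (slot p) 1
  | Sum.inr _ => 0

/-- The part of the unencoded stabilizer on the sender's qubits. -/
def senderStabilizer (e : (Fin c ⊕ Fin a) ⊕ Fin m ≃ Fin n) : GenIdx c a → Row (Fin n)
  | Sum.inl p => Pi.single (slot (p.1, e (Sum.inl (Sum.inl p.2)))) 1
  | Sum.inr j => rowZ (e (Sum.inl (Sum.inr j)))

/-- The part of the unencoded information-qubit matrix on the sender's qubits. -/
def senderInfo (e : (Fin c ⊕ Fin a) ⊕ Fin m ≃ Fin n) (p : Fin 2 × Fin m) : Row (Fin n) :=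
  Pi.single (slot (p.1, e (Sum.inr p.2))) 1

lemma initialStabilizer_apply (e : (Fin c ⊕ Fin a) ⊕ Fin m ≃ Fin n) (r : GenIdx c a) :
    initialStabilizer e r = join (receiverStabilizer r, senderStabilizer e r) := by
  rcases r with ⟨b, i⟩ | j
  · rw [receiverStabilizer, senderStabilizer, ← zero_add (Pi.single (slot (b, e _)) _),
      join_add_right, join_single_left, join_single_right]
    fin_cases b <;> rfl
  · exact (join_single_right (Sum.inl _) 1).symm

lemma initialInfo_apply (e : (Fin c ⊕ Fin a) ⊕ Fin m ≃ Fin n) (p : Fin 2 × Fin m) :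
    initialInfo e p = join (0, senderInfo e p) := by
  obtain ⟨b, i⟩ := p
  rw [senderInfo, join_single_right]
  fin_cases b <;> rfl

lemma symplecticForm_receiverStabilizer (r r' : GenIdx c a) :
    symplecticForm (receiverStabilizer r) (receiverStabilizer r') = standardForm c a r r' := by
  rcases r with p | j <;> rcases r' with p' | j'
  · rw [standardForm_inl_inl]
    simp only [receiverStabilizer, symplecticForm_single_left, Pi.single_apply, eq_comm, one_mul]
    split_ifs <;> simp
  all_goals simp [receiverStabilizer, standardForm]

lemma symplecticForm_fromCols {ρ : Type} (Z X : Matrix ρ (Fin n) K) (r r' : ρ) :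
    symplecticForm (Matrix.fromCols Z X r) (Matrix.fromCols Z X r') =
      shiftedSymplecticMatrix Z X r r' := by
  simp [symplecticForm_apply, shiftedSymplecticMatrix, Matrix.mul_apply, star_eq_timeReversal]

/-- The check matrix `H` of the sender, extended by the receiver's halves of the ebits. -/
def extendedStabilizer (H : GenIdx c a → Row (Fin n)) (r : GenIdx c a) :
    Row (FrameQubits c n) :=
  join (receiverStabilizer r, H r)

lemma symplecticForm_extendedStabilizer {H : GenIdx c a → Row (Fin n)}
    (hH : ∀ r r', symplecticForm (H r) (H r') = standardForm c a r r') (r r' : GenIdx c a) :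
    symplecticForm (extendedStabilizer H r) (extendedStabilizer H r') = 0 := by
  rw [extendedStabilizer, extendedStabilizer, symplecticForm_join,
    symplecticForm_receiverStabilizer, hH, CharTwo.add_self_eq_zero]

lemma linearIndependent_extendedStabilizer {H : GenIdx c a → Row (Fin n)}
    (h : LinearIndependent K H) : LinearIndependent K (extendedStabilizer H) := by
  refine LinearIndependent.of_comp
    (LinearMap.funLeft K K (Sum.map Sum.inr Sum.inr : Fin n ⊕ Fin n → _)) ?_
  convert h using 1
  ext r s
  exact join_apply_inr _ s

lemma card_gen_le {H : GenIdx c a → Row (Fin n)} (h : LinearIndependent K H)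
    (hH : ∀ r r', symplecticForm (H r) (H r') = standardForm c a r r') : c + a ≤ n := by
  have hcard := card_le_of_isotropic (linearIndependent_extendedStabilizer h)
    (symplecticForm_extendedStabilizer hH)
  simp only [Fintype.card_sum, Fintype.card_prod, Fintype.card_fin] at hcard
  lia

end Streams

section Logical

lemma symplecticForm_add_of_mem_span {Q ρ : Type} [Fintype Q] {S : ρ → Row Q}
    (hS : ∀ r r', symplecticForm (S r) (S r') = 0) {u v x y : Row Q}
    (hu : ∀ r, symplecticForm u (S r) = 0) (hv : ∀ r, symplecticForm v (S r) = 0)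
    (hx : x ∈ Submodule.span K (Set.range S)) (hy : y ∈ Submodule.span K (Set.range S)) :
    symplecticForm (u + x) (v + y) = symplecticForm u v := by
  have huy : symplecticForm u y = 0 :=
    (Submodule.span_le (p := LinearMap.ker (symplecticForm u))).2 (Set.range_subset_iff.2 hu) hy
  have hvx : symplecticForm v x = 0 :=
    (Submodule.span_le (p := LinearMap.ker (symplecticForm v))).2 (Set.range_subset_iff.2 hv) hx
  have hxy : symplecticForm x y = 0 := symplecticForm_eq_zero_of_mem_span hS hx hy
  simp only [map_add, LinearMap.add_apply, huy, hxy, symplecticForm_isRefl.eq_zero hvx, add_zero]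

variable {n c a m : ℕ}

lemma initialInfo_mem_laurentSubring (e : (Fin c ⊕ Fin a) ⊕ Fin m ≃ Fin n) (p : Fin 2 × Fin m)
    (s : FrameQubits c n ⊕ FrameQubits c n) : initialInfo e p s ∈ laurentSubring := by
  rw [initialInfo_apply, senderInfo, join_single_right, Pi.single_apply]
  split_ifs
  exacts [one_mem _, zero_mem _]

lemma exists_decoder (e : (Fin c ⊕ Fin a) ⊕ Fin m ≃ Fin n)
    {S : GenIdx c a → Row (FrameQubits c n)} (hS : ∀ r r', symplecticForm (S r) (S r') = 0) :
    ∃ g ∈ elementaryGroup laurentSubring Finset.univ,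
      ∀ (p : Fin 2 × Fin m) (r : GenIdx c a), symplecticForm (initialInfo e p) (g (S r)) = 0 := by
  rcases Nat.eq_zero_or_pos m with rfl | hm
  · exact ⟨1, one_mem _, fun p => p.2.elim0⟩
  let φ : Fin m ↪ FrameQubits c n :=
    (Function.Embedding.inr.trans e.toEmbedding).trans Function.Embedding.inr
  have hφ : ∀ j, φ j ∉ (Finset.univ.map φ)ᶜ := by simp
  have hn : c + a + m = n := by simpa using Fintype.card_congr e
  have hcard : (Finset.univ.map φ)ᶜ.card = c + (c + a) := by
    rw [Finset.card_compl, Finset.card_map]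
    simp only [Fintype.card_sum, Fintype.card_fin, Finset.card_univ]
    lia
  obtain ⟨g, hg, hgS⟩ := exists_mem_elementaryGroup_map_isotropic
    (A := laurentSubring) (size := size) (T₀ := (Finset.univ.map φ)ᶜ)
    (S := Submodule.span K (Set.range S)) (fun _ => star_mem_laurentSubring)
    (fun _ ha _ => exists_add_mul_size_lt ha) exists_common_denominator
    (by simp only [hcard, Fintype.card_sum, Fintype.card_fin]; lia)
    (fun u hu v hv => symplecticForm_eq_zero_of_mem_span hS hu hv)
    ((finrank_range_le_card S).trans (by simp [hcard]; lia))
  refine ⟨g, hg, fun p r => ?_⟩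
  rw [initialInfo_apply, senderInfo, join_single_right, symplecticForm_single_left,
    hgS _ (Submodule.subset_span ⟨r, rfl⟩), star_zero, mul_zero]
  rintro ⟨q, hq, h⟩
  have hq_eq : q = φ p.2 :=
    (congrArg qubit h).trans (by rw [qubit_swap, qubit_map, qubit_slot]; rfl)
  exact hφ _ (hq_eq ▸ hq)

lemma symplecticForm_initialInfo (e : (Fin c ⊕ Fin a) ⊕ Fin m ≃ Fin n) (p p' : Fin 2 × Fin m) :
    symplecticForm (initialInfo e p) (initialInfo e p') =
      if slot p' = (slot p).swap then 1 else 0 := by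
  rw [initialInfo_apply, initialInfo_apply, symplecticForm_join, senderInfo, senderInfo]
  simp only [map_zero, zero_add, symplecticForm_single_left, one_mul, Pi.single_apply,
    eq_comm (a := (slot _).swap), slot_eq_swap_iff, e.injective.eq_iff, Sum.inr_injective.eq_iff]
  split_ifs <;> simp

lemma exists_cancel_receiver (H : GenIdx c a → Row (Fin n)) {v : Row (FrameQubits c n)}
    (hv : ∀ s, v s ∈ laurentSubring) :
    ∃ (l : GenIdx c a → Laurent) (w : Row (Fin n)), (∀ j, l (Sum.inr j) = 0) ∧
      v + ∑ r, Laurent.toK (l r) • extendedStabilizer H r = join (0, w) := by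
  choose f hf using hv
  have hreceiver (s : Fin c ⊕ Fin c) : v (s.map Sum.inl Sum.inl) +
      ∑ p, Laurent.toK (f ((slot p).map Sum.inl Sum.inl)) *
        (Pi.single (slot p) 1 : Row (Fin c)) s = 0 := by
    rw [slot.sum_comp fun t =>
      Laurent.toK (f (t.map Sum.inl Sum.inl)) * (Pi.single t 1 : Row (Fin c)) s]
    simp [Pi.single_apply, hf, CharTwo.add_self_eq_zero]
  let l : GenIdx c a → Laurent := Sum.elim (fun p => f ((slot p).map Sum.inl Sum.inl)) 0
  let v' := v + ∑ r, Laurent.toK (l r) • extendedStabilizer H r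
  let w : Row (Fin n) := fun s => v' (s.map Sum.inr Sum.inr)
  refine ⟨l, w, fun j => rfl, row_ext (fun s => ?_) fun s => (join_apply_inr (0, w) s).symm⟩
  rw [join_apply_inl]
  refine Eq.trans ?_ (hreceiver s)
  simp [l, extendedStabilizer, receiverStabilizer, Fintype.sum_sum_type]

lemma exists_logical_rows (e : (Fin c ⊕ Fin a) ⊕ Fin m ≃ Fin n) {H : GenIdx c a → Row (Fin n)}
    (hH : ∀ r r', symplecticForm (H r) (H r') = standardForm c a r r') :
    ∃ g ∈ elementaryGroup laurentSubring (Finset.univ : Finset (FrameQubits c n)),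
      ∃ (L : Matrix (Fin 2 × Fin m) (GenIdx c a) Laurent) (w : Fin 2 × Fin m → Row (Fin n)),
        (∀ p j, L p (Sum.inr j) = 0) ∧
        (∀ p, g (join (0, w p)) =
          initialInfo e p + ∑ r, Laurent.toK (L p r) • g (extendedStabilizer H r)) ∧
        (∀ p p', symplecticForm (w p) (w p') = if slot p' = (slot p).swap then 1 else 0) ∧
        ∀ p r, symplecticForm (w p) (H r) = 0 := by
  have hS := symplecticForm_extendedStabilizer hH
  obtain ⟨g, hg, hgS⟩ := exists_decoder e hS
  have hg_isometry := (elementaryGroup_le_localIsometryGroup laurentSubring _ hg).1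
  have hgg : ∀ u, g (g⁻¹ u) = u := fun u => g.apply_symm_apply u
  choose l w hl hw using fun p => exists_cancel_receiver H
    (elementaryGroup_apply_mem (fun _ => star_mem_laurentSubring) (inv_mem hg)
      (initialInfo_mem_laurentSubring e p))
  have hvS : ∀ p r, symplecticForm (g⁻¹ (initialInfo e p)) (extendedStabilizer H r) = 0 :=
    fun p r => by rw [← hg_isometry, hgg, hgS]
  have hspan : ∀ p, ∑ r, Laurent.toK (l p r) • extendedStabilizer H r ∈
      Submodule.span K (Set.range (extendedStabilizer H)) := fun p =>
    Submodule.sum_mem _ fun r _ => Submodule.smul_mem _ _ (Submodule.subset_span ⟨r, rfl⟩)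
  have hwS : ∀ p r, symplecticForm (join (0, w p)) (extendedStabilizer H r) = 0 := fun p r => by
    rw [← hw, map_add, LinearMap.add_apply, hvS, zero_add]
    exact symplecticForm_eq_zero_of_mem_span hS (hspan p) (Submodule.subset_span ⟨r, rfl⟩)
  refine ⟨g, hg, Matrix.of l, w, hl, fun p => ?_, fun p p' => ?_, fun p r => ?_⟩
  · rw [← hw, map_add, hgg, map_sum]
    exact congrArg _ (Finset.sum_congr rfl fun r _ => map_smul g _ _)
  · calc symplecticForm (w p) (w p')
        = symplecticForm (join ((0 : Row (Fin c)), w p)) (join (0, w p')) := by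
          simp [symplecticForm_join]
      _ = symplecticForm (g⁻¹ (initialInfo e p)) (g⁻¹ (initialInfo e p')) := by
          rw [← hw, ← hw, symplecticForm_add_of_mem_span hS (hvS p) (hvS p')
            (hspan p) (hspan p')]
      _ = _ := by rw [← hg_isometry, hgg, hgg, symplecticForm_initialInfo]
  · simpa [extendedStabilizer, symplecticForm_join] using hwS p r

end Logical

section Encoder

lemma eq_sum_smul_single {R S α : Type*} [Semiring R] [DecidableEq S] [Fintype α] {φ : α → S}
    (hφ : φ.Injective) {u : S → R} (hu : ∀ s ∉ Set.range φ, u s = 0) :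
    u = ∑ j, u (φ j) • (Pi.single (φ j) 1 : S → R) := by
  ext s
  by_cases hs : s ∈ Set.range φ
  · obtain ⟨j, rfl⟩ := hs
    rw [Finset.sum_apply, Finset.sum_eq_single_of_mem j (Finset.mem_univ j) fun k _ hk => ?_]
    · simp
    · simp [Pi.single_eq_of_ne' (hφ.ne hk)]
  · rw [hu s hs, Finset.sum_apply, Finset.sum_eq_zero fun j _ => ?_]
    rw [Pi.smul_apply, Pi.single_eq_of_ne fun h => hs ⟨j, h.symm⟩, smul_zero]

lemma isUnit_of_linearIndependent_mul {F ρ κ : Type*} [Field F] [Fintype ρ] [DecidableEq ρ]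
    {R : Matrix ρ ρ F} {M : Matrix ρ κ F} (h : LinearIndependent F (R * M).row) : IsUnit R := by
  rw [← Matrix.linearIndependent_rows_iff_isUnit, ← Matrix.vecMul_injective_iff]
  rw [← Matrix.vecMul_injective_iff] at h
  refine Function.Injective.of_comp (f := fun x => Matrix.vecMul x M) ?_
  simpa only [Function.comp_def, Matrix.vecMul_vecMul] using h

variable {n c a m : ℕ}

lemma exists_map_stabilizer (e : (Fin c ⊕ Fin a) ⊕ Fin m ≃ Fin n) {H : GenIdx c a → Row (Fin n)}
    {w : Fin 2 × Fin m → Row (Fin n)}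
    (hH : ∀ r r', symplecticForm (H r) (H r') = standardForm c a r r')
    (hw : ∀ p p', symplecticForm (w p) (w p') = if slot p' = (slot p).swap then 1 else 0)
    (hwH : ∀ p r, symplecticForm (w p) (H r) = 0) :
    ∃ g ∈ cliffordGroup K Finset.univ,
      (∀ p, g (H (Sum.inl p)) = senderStabilizer e (Sum.inl p)) ∧
      (∀ p, g (w p) = senderInfo e p) ∧
      ∀ j, ∃ z : Fin a → K, g (H (Sum.inr j)) = ∑ j', z j' • senderStabilizer e (Sum.inr j') := by
  let e' : (Fin c ⊕ Fin m) ⊕ Fin a ≃ Fin n :=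
    (((Equiv.sumAssoc _ _ _).trans ((Equiv.refl _).sumCongr (Equiv.sumComm _ _))).trans
      (Equiv.sumAssoc _ _ _).symm).trans e
  let W (p : Fin 2 × (Fin c ⊕ Fin m)) : Row (Fin n) :=
    Sum.elim (fun i => H (Sum.inl (p.1, i))) (fun i => w (p.1, i)) p.2
  have hW : ∀ p p', symplecticForm (W p) (W p') = if slot p' = (slot p).swap then 1 else 0 := by
    rintro ⟨b, i | i⟩ ⟨b', i' | i'⟩ <;> simp only [W, Sum.elim_inl, Sum.elim_inr]
    · simp [hH, standardForm_inl_inl, slot_eq_swap_iff]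
    · simp [symplecticForm_isRefl.eq_zero (hwH _ _), slot_eq_swap_iff]
    · simp [hwH, slot_eq_swap_iff]
    · simp [hw, slot_eq_swap_iff]
  have hWr : ∀ p j, symplecticForm (W p) (H (Sum.inr j)) = 0 := by
    rintro ⟨b, i | i⟩ j
    · simp [W, hH, standardForm]
    · exact hwH _ _
  obtain ⟨g, hg, hgW, hgr⟩ := exists_map_symplectic_basis e' (w := W ∘ slot.symm)
    (r := H ∘ Sum.inr) (slot.surjective.forall₂.2 (by simpa using hW))
    (slot.surjective.forall.2 (by simpa using hWr)) (by simp [hH, standardForm])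
  replace hgW : ∀ b i, g (W (b, i)) = Pi.single (slot (b, e' (Sum.inl i))) 1 := fun b i => by
    have h := hgW (slot (b, i))
    rwa [slot_map, Function.comp_apply, slot.symm_apply_apply] at h
  have hinj : (Sum.inl ∘ e' ∘ Sum.inr : Fin a → Fin n ⊕ Fin n).Injective :=
    Sum.inl_injective.comp (e'.injective.comp Sum.inr_injective)
  exact ⟨g, hg, fun p => hgW p.1 (Sum.inl p.2), fun p => hgW p.1 (Sum.inr p.2),
    fun j => ⟨_, eq_sum_smul_single hinj (hgr j)⟩⟩

lemma exists_encoder (e : (Fin c ⊕ Fin a) ⊕ Fin m ≃ Fin n) {H : GenIdx c a → Row (Fin n)}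
    {w : Fin 2 × Fin m → Row (Fin n)}
    (hH : ∀ r r', symplecticForm (H r) (H r') = standardForm c a r r')
    (hw : ∀ p p', symplecticForm (w p) (w p') = if slot p' = (slot p).swap then 1 else 0)
    (hwH : ∀ p r, symplecticForm (w p) (H r) = 0) :
    ∃ E : List (Gate (Fin n)),
      (∀ p, runRow E (senderStabilizer e (Sum.inl p)) = H (Sum.inl p)) ∧
      (∀ p, runRow E (senderInfo e p) = w p) ∧
      ∀ j, ∃ z : Fin a → K,
        H (Sum.inr j) = ∑ j', z j' • runRow E (senderStabilizer e (Sum.inr j')) := by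
  obtain ⟨g, hg, hgH, hgw, hgr⟩ := exists_map_stabilizer e hH hw hwH
  obtain ⟨E, hE⟩ := cliffordGroup_le_circuitMonoid _ (Subgroup.inv_mem _ hg)
  replace hE (u : Row (Fin n)) : runRow E u = g⁻¹ u := by rw [← hE, List.map_id]
  have hgg : ∀ u, g⁻¹ (g u) = u := fun u => g.symm_apply_apply u
  refine ⟨E, fun p => by rw [hE, ← hgH, hgg], fun p => by rw [hE, ← hgw, hgg], fun j => ?_⟩
  obtain ⟨z, hz⟩ := hgr j
  refine ⟨z, ?_⟩
  rw [← hgg (H (Sum.inr j)), hz, map_sum]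
  simp only [map_smul, hE]

lemma encodes_of_span (e : (Fin c ⊕ Fin a) ⊕ Fin m ≃ Fin n) {E : List (Gate (Fin n))}
    {H : Matrix (GenIdx c a) (Fin n ⊕ Fin n) K} (hrank : LinearIndependent K H.row)
    (hE : ∀ p, runRow E (senderStabilizer e (Sum.inl p)) = H (Sum.inl p))
    (hz : ∀ j, ∃ z : Fin a → K,
      H (Sum.inr j) = ∑ j', z j' • runRow E (senderStabilizer e (Sum.inr j'))) :
    Encodes e E H := by
  choose z hz using hz
  let R : Matrix (GenIdx c a) (GenIdx c a) K := Matrix.fromBlocks 1 0 0 (Matrix.of z)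
  have hsender (r : GenIdx c a) : senderPart (run (onSender E) (initialStabilizer e)) r =
      runRow E (senderStabilizer e r) := by
    ext s
    change runRow (onSender E) (initialStabilizer e r) (s.map Sum.inr Sum.inr) = _
    rw [initialStabilizer_apply, runRow_onSender, join_apply_inr]
  have hR : H = R * senderPart (run (onSender E) (initialStabilizer e)) := by
    ext r s
    simp only [Matrix.mul_apply, hsender]
    rcases r with p | j
    · simp [R, Matrix.one_apply, ← hE]
    · simp [R, hz, Finset.sum_apply]
  exact ⟨R, isUnit_of_linearIndependent_mul (hR ▸ hrank), hR⟩

end Encoder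

section Decoder

variable {n c a m : ℕ}

lemma decodes_of_mul (e : (Fin c ⊕ Fin a) ⊕ Fin m ≃ Fin n) {E : List (Gate (Fin n))}
    {F : List (Gate (FrameQubits c n))} {H : GenIdx c a → Row (Fin n)}
    {L : Matrix (Fin 2 × Fin m) (GenIdx c a) Laurent} {w : Fin 2 × Fin m → Row (Fin n)}
    (hE : ∀ p, runRow E (senderStabilizer e (Sum.inl p)) = H (Sum.inl p))
    (hw : ∀ p, runRow E (senderInfo e p) = w p) (hL : ∀ p j, L p (Sum.inr j) = 0)
    (hF : ∀ p, runRow F (join (0, w p)) =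
      initialInfo e p + ∑ r, Laurent.toK (L p r) • runRow F (extendedStabilizer H r)) :
    Decodes e E F := by
  have hinfo (p : Fin 2 × Fin m) : run (onSender E) (initialInfo e) p = join (0, w p) := by
    change runRow (onSender E) (initialInfo e p) = _
    rw [initialInfo_apply, runRow_onSender, hw]
  have hebit (p : Fin 2 × Fin c) : run (onSender E) (initialStabilizer e) (Sum.inl p) =
      extendedStabilizer H (Sum.inl p) := by
    change runRow (onSender E) (initialStabilizer e (Sum.inl p)) = _
    rw [initialStabilizer_apply, runRow_onSender, hE, extendedStabilizer]
  refine ⟨L, Matrix.ext fun p s => ?_⟩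
  change runRow F (run (onSender E) (initialInfo e) p) s = _
  rw [hinfo, hF]
  simp [Matrix.mul_apply, run, hL, ← hebit]

end Decoder

end QConv

end

theorem mainTheorem2 (n c a : ℕ) (k : ℤ) (ha : (a : ℤ) = n - k - 2 * c)
    (Z X : Matrix (QConv.GenIdx c a) (Fin n) QConv.K)
    (hrank : LinearIndependent QConv.K (Matrix.fromCols Z X).row)
    (hΩ : QConv.shiftedSymplecticMatrix Z X = QConv.standardForm c a) :
    ∃ (m : ℕ) (e : (Fin c ⊕ Fin a) ⊕ Fin m ≃ Fin n)
      (E : List (QConv.Gate (Fin n)))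
      (F : List (QConv.FiniteGate (QConv.FrameQubits c n))),
      (m : ℤ) = k + c ∧
      QConv.IsOnline E ∧
      QConv.Encodes e E (Matrix.fromCols Z X) ∧
      QConv.IsOnline (F.map QConv.Gate.finite) ∧
      QConv.IsFiniteDepth (F.map QConv.Gate.finite) ∧
      QConv.Decodes e E (F.map QConv.Gate.finite) := by
  open QConv in
  have hH : ∀ r r', symplecticForm (Matrix.fromCols Z X r) (Matrix.fromCols Z X r') =
      standardForm c a r r' := fun r r' => by rw [symplecticForm_fromCols, hΩ]
  obtain ⟨m, hm⟩ := Nat.exists_eq_add_of_le (card_gen_le hrank hH)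
  have e : (Fin c ⊕ Fin a) ⊕ Fin m ≃ Fin n := Fintype.equivOfCardEq (by simp [hm])
  obtain ⟨g, hg, L, w, hL, hgw, hw, hwH⟩ := exists_logical_rows e hH
  obtain ⟨E, hEH, hEw, hEz⟩ := exists_encoder e hH hw hwH
  obtain ⟨F, hF⟩ := elementaryGroup_le_circuitMonoid _ hg
  refine ⟨m, e, E, F, by lia, isOnline _, encodes_of_span e hrank hEH hEz, isOnline _,
    isFiniteDepth_of_runRow_eq hg hF, decodes_of_mul e hEH hEw hL fun p => ?_⟩
  simp only [hF, hgw]
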